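/- Let $M$ be a smooth manifold of dimension $n\ge 3$ and let $F\colon TM\to\mathbb R$ be a Finsler metric: $F$ is continuous, smooth on the complement of the zero section, $F(tv)=tF(v)$ for all $t>0$, and, in induced coordinates $(x^i,y^i)$ of $TM$, the Hessian $g_{ij}=\partial^2E/\partial y^i\partial y^j$ of the energy $E=\tfrac12F^2$ is positive definite at all nonzero vectors. Let $(g^{ij})$ be the inverse of $(g_{ij})$, let $$G^l=\tfrac12\,g^{lm}\Big(y^k\frac{\partial^2E}{\partial y^m\partial x^k}-\frac{\partial E}{\partial x^m}\Big)$$ be the geodesic spray coefficients, and let $$P^l_{ijk}=-\frac{\partial^3G^l}{\partial y^i\partial y^j\partial y^k}$$ be the mixed curvature tensor of the Berwald connection. Let $\alpha\colon M\to\mathbb R$ be a smooth function with $d_p\alpha\ne0$ at a point $p\in M$, write $\alpha_l=\partial\alpha/\partial x^l$, and let $\tilde P^l_{ijk}$ be the mixed curvature tensor of the conformally changed metric $\tilde F=e^{\alpha}F$. Suppose that 1. all sectional curvatures of the indicatrix hypersurface $\{v\in T_pM : F(v)=1\}$, with the Riemannian metric induced by $g_{ij}$ on $T_pM\setminus\{0\}$,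 are positive; 2. $\tilde P^l_{ijk}\alpha_l=P^l_{ijk}\alpha_l$ at every nonzero $v\in T_pM$, for all $i,j,k$ (summation over $l$). Put $X^l=g^{lm}\alpha_m$ and $X^l_s=\partial X^l/\partial y^s$. Then at every nonzero $v\in T_pM$ the Gram determinant, with respect to $g_{ij}$, of the vector fields $$X^l\frac{\partial}{\partial y^l}-\frac{y^m\alpha_m}{2E}\,y^l\frac{\partial}{\partial y^l}\qquad\text{and}\qquad X^sX^l_s\,\frac{\partial}{\partial y^l}$$ is zero, and these two vector fields are linearly dependent there. -/

import Mathlib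

open scoped Manifold ContDiff

namespace FinslerConformal

noncomputable section

/-- The partial derivative `∂f/∂uⁱ` at `u`. -/
def pd {n : ℕ} (i : Fin n) (f : EuclideanSpace ℝ (Fin n) → ℝ) (u : EuclideanSpace ℝ (Fin n)) : ℝ :=
  fderiv ℝ f u (EuclideanSpace.single i 1)

/-! ### Riemannian metrics in coordinates -/

/-- The Christoffel symbol `Γᵏᵢⱼ` of the Levi-Civita connection of the metric `h` on an open part
of `ℝᵐ`. -/
def christoffel {m : ℕ} (h : EuclideanSpace ℝ (Fin m) → Matrix (Fin m) (Fin m) ℝ)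
    (k i j : Fin m) (z : EuclideanSpace ℝ (Fin m)) : ℝ :=
  1 / 2 * ∑ l, (h z)⁻¹ k l *
    (pd i (fun w => h w j l) z + pd j (fun w => h w i l) z - pd l (fun w => h w i j) z)

/-- The component `Rˡₖᵢⱼ` of the Riemann curvature tensor:
`R(∂ᵢ, ∂ⱼ)∂ₖ = ∇ᵢ∇ⱼ∂ₖ - ∇ⱼ∇ᵢ∂ₖ = ∑ₗ Rˡₖᵢⱼ ∂ₗ`. -/
def riemann {m : ℕ} (h : EuclideanSpace ℝ (Fin m) → Matrix (Fin m) (Fin m) ℝ)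
    (l k i j : Fin m) (z : EuclideanSpace ℝ (Fin m)) : ℝ :=
  pd i (christoffel h l j k) z - pd j (christoffel h l i k) z
    + ∑ s, (christoffel h l i s z * christoffel h s j k z
      - christoffel h l j s z * christoffel h s i k z)

/-- The inner product of two vectors, given by their components, with respect to the Gram
matrix `g` of a basis. -/
def inner2 {m : ℕ} (g : Matrix (Fin m) (Fin m) ℝ) (a b : Fin m → ℝ) : ℝ :=
  ∑ i, ∑ j, g i j * a i * b j

/-- The Gram determinant of two vectors with respect to `g`. -/
def gramDet {m : ℕ} (g : Matrix (Fin m) (Fin m) ℝ) (a b : Fin m → ℝ) : ℝ :=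
  Matrix.det !![inner2 g a a, inner2 g a b; inner2 g b a, inner2 g b b]

/-- The sectional curvature `h(R(a, b)b, a) / (h(a, a) h(b, b) - h(a, b)²)` at `z` of the plane
spanned by `a` and `b`. -/
def sectionalCurvature {m : ℕ} (h : EuclideanSpace ℝ (Fin m) → Matrix (Fin m) (Fin m) ℝ)
    (z : EuclideanSpace ℝ (Fin m)) (a b : Fin m → ℝ) : ℝ :=
  inner2 (h z) (fun l => ∑ k, ∑ i, ∑ j, riemann h l k i j z * b k * a i * b j) a
    / gramDet (h z) a b

/-! ### Finsler quantities in induced coordinates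

Below `L x y` is a Finslerian metric function written in the coordinates `x¹, …, xⁿ, y¹, …, yⁿ` of
the tangent bundle that are induced by local coordinates of the base. -/

/-- The energy `E = F² / 2`. -/
def energy {n : ℕ} (L : EuclideanSpace ℝ (Fin n) → EuclideanSpace ℝ (Fin n) → ℝ)
    (x y : EuclideanSpace ℝ (Fin n)) : ℝ :=
  1 / 2 * L x y ^ 2

/-- The Riemann-Finsler metric `gᵢⱼ = ∂²E/∂yⁱ∂yʲ`. -/
def metric {n : ℕ} (L : EuclideanSpace ℝ (Fin n) → EuclideanSpace ℝ (Fin n) → ℝ)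
    (x y : EuclideanSpace ℝ (Fin n)) : Matrix (Fin n) (Fin n) ℝ :=
  Matrix.of fun i j => pd i (pd j (energy L x)) y

/-- The geodesic spray coefficient
`Gˡ = (1/2) gˡᵐ (yᵏ ∂²E/∂yᵐ∂xᵏ - ∂E/∂xᵐ)`. -/
def spray {n : ℕ} (L : EuclideanSpace ℝ (Fin n) → EuclideanSpace ℝ (Fin n) → ℝ)
    (l : Fin n) (x y : EuclideanSpace ℝ (Fin n)) : ℝ :=
  1 / 2 * ∑ m, (metric L x y)⁻¹ l m *
    ((∑ k, y k * pd m (fun y' => pd k (fun x' => energy L x' y') x) y)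
      - pd m (fun x' => energy L x' y) x)

/-- The mixed curvature `Pˡᵢⱼₖ = -∂³Gˡ/∂yᵏ∂yʲ∂yⁱ` of the Berwald connection. -/
def mixedCurvature {n : ℕ} (L : EuclideanSpace ℝ (Fin n) → EuclideanSpace ℝ (Fin n) → ℝ)
    (l i j k : Fin n) (x y : EuclideanSpace ℝ (Fin n)) : ℝ :=
  -pd k (pd j (pd i (spray L l x))) y

/-- The component `Xˡ = gˡᵐ αₘ` of the Finslerian gradient of a function `a` of the position. -/
def grad {n : ℕ} (L : EuclideanSpace ℝ (Fin n) → EuclideanSpace ℝ (Fin n) → ℝ)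
    (a : EuclideanSpace ℝ (Fin n) → ℝ) (l : Fin n) (x y : EuclideanSpace ℝ (Fin n)) : ℝ :=
  ∑ m, (metric L x y)⁻¹ l m * pd m a x

/-- The components `Xˡ - (yᵐαₘ / 2E) yˡ` of the projected Finslerian gradient. -/
def projGrad {n : ℕ} (L : EuclideanSpace ℝ (Fin n) → EuclideanSpace ℝ (Fin n) → ℝ)
    (a : EuclideanSpace ℝ (Fin n) → ℝ) (x y : EuclideanSpace ℝ (Fin n)) : Fin n → ℝ :=
  fun l => grad L a l x y - (∑ m, y m * pd m a x) / (2 * energy L x y) * y l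

/-- The components `Xˢ Xˡₛ`, where `Xˡₛ = ∂Xˡ/∂yˢ`. -/
def gradDerivGrad {n : ℕ} (L : EuclideanSpace ℝ (Fin n) → EuclideanSpace ℝ (Fin n) → ℝ)
    (a : EuclideanSpace ℝ (Fin n) → ℝ) (x y : EuclideanSpace ℝ (Fin n)) : Fin n → ℝ :=
  fun l => ∑ s, grad L a s x y * pd s (grad L a l x) y

/-! ### The indicatrix -/

/-- `σ` restricted to `U` is a regular local parametrization of the indicatrix hypersurface
`{y | L x y = 1}` of the tangent space at the point with coordinates `x`. -/
structure IsIndicatrixParam {n : ℕ}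
    (L : EuclideanSpace ℝ (Fin n) → EuclideanSpace ℝ (Fin n) → ℝ) (x : EuclideanSpace ℝ (Fin n))
    (U : Set (EuclideanSpace ℝ (Fin (n - 1))))
    (σ : EuclideanSpace ℝ (Fin (n - 1)) → EuclideanSpace ℝ (Fin n)) : Prop where
  isOpen : IsOpen U
  smooth : ContDiffOn ℝ ∞ σ U
  immersive : ∀ z ∈ U, Function.Injective (fderiv ℝ σ z)
  mem_indicatrix : ∀ z ∈ U, L x (σ z) = 1

/-- The Riemannian metric induced on the indicatrix by the Riemann-Finsler metric, in the
parametrization `σ`. -/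
def inducedMetric {n : ℕ}
    (L : EuclideanSpace ℝ (Fin n) → EuclideanSpace ℝ (Fin n) → ℝ) (x : EuclideanSpace ℝ (Fin n))
    (σ : EuclideanSpace ℝ (Fin (n - 1)) → EuclideanSpace ℝ (Fin n))
    (z : EuclideanSpace ℝ (Fin (n - 1))) : Matrix (Fin (n - 1)) (Fin (n - 1)) ℝ :=
  Matrix.of fun a b =>
    inner2 (metric L x (σ z)) (fun i => pd a (fun w => σ w i) z) (fun i => pd b (fun w => σ w i) z)

/-- All sectional curvatures of the indicatrix hypersurface, as a Riemannian submanifold of the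
punctured tangent space with the Riemann-Finsler metric, are positive. -/
def IndicatrixPosCurved {n : ℕ}
    (L : EuclideanSpace ℝ (Fin n) → EuclideanSpace ℝ (Fin n) → ℝ)
    (x : EuclideanSpace ℝ (Fin n)) : Prop :=
  ∀ (U : Set (EuclideanSpace ℝ (Fin (n - 1))))
    (σ : EuclideanSpace ℝ (Fin (n - 1)) → EuclideanSpace ℝ (Fin n)),
    IsIndicatrixParam L x U σ → ∀ z ∈ U, ∀ a b : Fin (n - 1) → ℝ,
      LinearIndependent ℝ ![a, b] → 0 < sectionalCurvature (inducedMetric L x σ) z a b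

/-! ### Finsler metrics on manifolds -/

/-- The expression of a function `F` on the tangent bundle in the coordinates induced by the
chart `e`: the pair `(x, y)` stands for the vector `∑ᵢ yⁱ ∂/∂uⁱ` at the point with coordinates
`x`. -/
def inChart {n : ℕ} {M : Type*} [TopologicalSpace M] [ChartedSpace (EuclideanSpace ℝ (Fin n)) M]
    (F : TangentBundle (𝓡 n) M → ℝ) (e : OpenPartialHomeomorph M (EuclideanSpace ℝ (Fin n)))
    (x y : EuclideanSpace ℝ (Fin n)) : ℝ :=
  F ⟨e.symm x, mfderiv (𝓡 n) (𝓡 n) e.symm x y⟩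

/-- `F` is a Finsler metric (Finslerian metric function) on the `n`-manifold `M`. -/
structure IsFinslerMetric {n : ℕ} {M : Type*} [TopologicalSpace M]
    [ChartedSpace (EuclideanSpace ℝ (Fin n)) M] [IsManifold (𝓡 n) ∞ M]
    (F : TangentBundle (𝓡 n) M → ℝ) : Prop where
  continuous : Continuous F
  smooth : ContMDiffOn (𝓡 n).tangent 𝓘(ℝ, ℝ) ∞ F {v | v.2 ≠ 0}
  homogeneous : ∀ (p : M) (v : TangentSpace (𝓡 n) p) (t : ℝ), 0 < t → F ⟨p, t • v⟩ = t * F ⟨p, v⟩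
  posDef : ∀ e ∈ IsManifold.maximalAtlas (𝓡 n) ∞ M, ∀ x ∈ e.target,
    ∀ y : EuclideanSpace ℝ (Fin n), y ≠ 0 → (metric (inChart F e) x y).PosDef

/-- The conformal change `e^α F`. -/
def conformalChange {n : ℕ} {M : Type*} [TopologicalSpace M]
    [ChartedSpace (EuclideanSpace ℝ (Fin n)) M]
    (α : M → ℝ) (F : TangentBundle (𝓡 n) M → ℝ) : TangentBundle (𝓡 n) M → ℝ :=
  fun v => Real.exp (α v.proj) * F v

end

end FinslerConformal

open FinslerConformal

/-!
On the tangent space at `p` let `E` be the energy and `α = dα`. The conformal change alters the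
geodesic spray by a vector whose pairing with `α` is `α(y)² - E(y) |grad α|²`, so the invariance of
the mixed curvature in the direction `α` says that the third derivatives of this function vanish:
`2 E(y) |grad α|² = q(y, y)` for a symmetric bilinear form `q`. Put `D = q - α ⊗ α`; it is
positive semidefinite by the Cauchy–Schwarz inequality for the metric at `y`, and
`D(y, y) = 0` where `dE(y)` is a multiple of `α`.

For `m ∈ ker α` let `y(φ)` be the curve with Legendre transform
`dE(y(φ)) = cos φ α + sin φ q(m, ·)`. The function
`S(φ) = q(m, m) α(y) / q(m, y) - cot φ` has the derivative
`(q(m, y)² - q(m, m) D(y, y)) / (sin² φ q(m, y)²) ≤ 0`, where Cauchy–Schwarz for `D` gives the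
sign. It has finite limits at the multiples of `π`, because `E` is smooth at the two vectors with
Legendre transforms `± α`, and these limits are the same on both sides; being periodic and antitone
it is constant. So equality holds in Cauchy–Schwarz, `D(y, ·)` is proportional to `q(m, ·)`, and
`q(y, ·)` lies in the span of `α` and `dE(y)`. Hence the differential of `|grad α|²` is a multiple
of `α - (α(y) / 2E) dE(y)`, and raising the index gives the two vector fields of the theorem.
-/

namespace FinslerConformal

open Filter Topology Set

/-! ### Symmetric bilinear forms -/

section Bilinear

variable {V : Type*} [NormedAddCommGroup V] [NormedSpace ℝ V] {B : V →L[ℝ] V →L[ℝ] ℝ}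

theorem bilin_sq_le (hs : ∀ v w, B v w = B w v) (hB : ∀ v, 0 ≤ B v v) (v w : V) :
    B v w ^ 2 ≤ B v v * B w w :=
  LinearMap.BilinForm.apply_sq_le_of_symm B.toLinearMap₁₂ hB ⟨hs⟩ v w

theorem bilin_eq_zero_of_apply_self (hs : ∀ v w, B v w = B w v) (hB : ∀ v, 0 ≤ B v v) {v : V}
    (hv : B v v = 0) : B v = 0 := by
  ext w
  have h := bilin_sq_le hs hB v w
  rw [hv, zero_mul] at h
  exact pow_eq_zero_iff two_ne_zero |>.1 (h.antisymm (sq_nonneg _))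

theorem bilin_eq_smul_of_sq_eq (hs : ∀ v w, B v w = B w v) (hB : ∀ v, 0 ≤ B v v)
    {v w : V} (hv : B v v ≠ 0) (h : B v w ^ 2 = B v v * B w w) :
    B w = (B v w / B v v) • B v := by
  rw [← map_smul, ← sub_eq_zero, ← map_sub]
  apply bilin_eq_zero_of_apply_self hs hB
  simp only [map_sub, map_smul, sub_apply, smul_apply, smul_eq_mul, hs w v]
  field_simp
  linarith

theorem isInvertible_of_definite [FiniteDimensional ℝ V] (hB : ∀ v, v ≠ 0 → B v v ≠ 0) :
    B.IsInvertible := by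
  have hinj : Function.Injective (B : V →ₗ[ℝ] (V →L[ℝ] ℝ)) :=
    (injective_iff_map_eq_zero _).2 fun v hv => by
      by_contra hv0
      exact hB v hv0 (congrArg (fun θ : V →L[ℝ] ℝ => θ v) hv)
  have hrank : Module.finrank ℝ V = Module.finrank ℝ (V →L[ℝ] ℝ) :=
    Subspace.dual_finrank_eq.symm.trans
      (LinearMap.toContinuousLinearMap (𝕜 := ℝ) (E := V) (F' := ℝ)).finrank_eq
  exact ⟨(LinearEquiv.ofInjectiveOfFinrankEq _ hinj hrank).toContinuousLinearEquiv, rfl⟩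

end Bilinear

/-! ### Homogeneous functions -/

section Homogeneous

variable {V W : Type*} [NormedAddCommGroup V] [NormedSpace ℝ V]
  [NormedAddCommGroup W] [NormedSpace ℝ W]

theorem fderiv_apply_self_of_homogeneous {h : V → W} {k : ℕ} {y : V}
    (hh : ∀ t : ℝ, 0 < t → h (t • y) = t ^ k • h y) (hd : DifferentiableAt ℝ h y) :
    fderiv ℝ h y y = (k : ℝ) • h y := by
  have along_ray : HasDerivAt (fun t : ℝ => h (t • y)) (fderiv ℝ h y y) 1 := by
    have hray : HasDerivAt (fun t : ℝ => t • y) y 1 := by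
      simpa using (hasDerivAt_id (1 : ℝ)).smul_const y
    have hd1 : HasFDerivAt h (fderiv ℝ h y) ((1 : ℝ) • y) := by simpa using hd.hasFDerivAt
    exact hd1.comp_hasDerivAt (1 : ℝ) hray
  have power : HasDerivAt (fun t : ℝ => t ^ k • h y) ((k : ℝ) • h y) 1 := by
    simpa using (hasDerivAt_pow k (1 : ℝ)).smul_const (h y)
  refine along_ray.unique (power.congr_of_eventuallyEq ?_)
  filter_upwards [lt_mem_nhds (zero_lt_one : (0 : ℝ) < 1)] with t ht using hh t ht

theorem fderiv_smul_of_homogeneous {h : V → W} {k : ℕ}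
    (hh : ∀ (y : V) (t : ℝ), 0 < t → h (t • y) = t ^ (k + 1) • h y) (y : V) {t : ℝ} (ht : 0 < t) :
    fderiv ℝ h (t • y) = t ^ k • fderiv ℝ h y := by
  have hfun : (h <| t • ·) = t ^ (k + 1) • h := funext fun z => hh z t ht
  have : Invertible (t ^ (k + 1)) := invertibleOfNonzero (by positivity)
  have hd : t • fderiv ℝ h (t • y) = t • t ^ k • fderiv ℝ h y := by
    rw [← fderiv_comp_smul, hfun, smul_smul, ← pow_succ']
    exact fderiv_const_smul_of_invertible _
  exact smul_right_injective _ ht.ne' hd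

end Homogeneous

/-! ### Minkowski energies and their Legendre transform -/

/-- `E` is the energy of a Minkowski norm: positively homogeneous of degree two, and smooth with
positive definite Hessian away from the origin. -/
structure IsMinkowskiEnergy {V : Type*} [NormedAddCommGroup V] [NormedSpace ℝ V] (E : V → ℝ) :
    Prop where
  contDiffAt : ∀ y, y ≠ 0 → ContDiffAt ℝ ∞ E y
  homogeneous : ∀ (y : V) (t : ℝ), 0 < t → E (t • y) = t ^ 2 * E y
  hess_pos : ∀ y, y ≠ 0 → ∀ v, v ≠ 0 → 0 < fderiv ℝ (fderiv ℝ E) y v v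

namespace IsMinkowskiEnergy

variable {V : Type*} [NormedAddCommGroup V] [NormedSpace ℝ V] {E : V → ℝ}

theorem contDiffAt_fderiv (hE : IsMinkowskiEnergy E) {y : V} (hy : y ≠ 0) :
    ContDiffAt ℝ ∞ (fderiv ℝ E) y :=
  (hE.contDiffAt y hy).fderiv_right (by simp)

theorem hasFDerivAt (hE : IsMinkowskiEnergy E) {y : V} (hy : y ≠ 0) :
    HasFDerivAt E (fderiv ℝ E y) y :=
  ((hE.contDiffAt y hy).differentiableAt (by simp)).hasFDerivAt

theorem hasFDerivAt_fderiv (hE : IsMinkowskiEnergy E) {y : V} (hy : y ≠ 0) :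
    HasFDerivAt (fderiv ℝ E) (fderiv ℝ (fderiv ℝ E) y) y :=
  ((hE.contDiffAt_fderiv hy).differentiableAt (by simp)).hasFDerivAt

theorem fderiv_apply_self (hE : IsMinkowskiEnergy E) {y : V} (hy : y ≠ 0) :
    fderiv ℝ E y y = 2 * E y := by
  simpa using fderiv_apply_self_of_homogeneous (k := 2) (hE.homogeneous y)
    (hE.hasFDerivAt hy).differentiableAt

theorem fderiv_smul (hE : IsMinkowskiEnergy E) (y : V) {t : ℝ} (ht : 0 < t) :
    fderiv ℝ E (t • y) = t • fderiv ℝ E y := by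
  simpa using fderiv_smul_of_homogeneous (k := 1) hE.homogeneous y ht

theorem hess_self (hE : IsMinkowskiEnergy E) {y : V} (hy : y ≠ 0) :
    fderiv ℝ (fderiv ℝ E) y y = fderiv ℝ E y := by
  simpa using fderiv_apply_self_of_homogeneous (k := 1) (h := fderiv ℝ E) (y := y)
    (fun t ht => by simpa using hE.fderiv_smul y ht) (hE.hasFDerivAt_fderiv hy).differentiableAt

theorem hess_smul (hE : IsMinkowskiEnergy E) (y : V) {t : ℝ} (ht : 0 < t) :
    fderiv ℝ (fderiv ℝ E) (t • y) = fderiv ℝ (fderiv ℝ E) y := by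
  simpa using fderiv_smul_of_homogeneous (k := 0) (h := fderiv ℝ E)
    (fun y t ht => by simpa using hE.fderiv_smul y ht) y ht

theorem hess_symm (hE : IsMinkowskiEnergy E) {y : V} (hy : y ≠ 0) (v w : V) :
    fderiv ℝ (fderiv ℝ E) y v w = fderiv ℝ (fderiv ℝ E) y w v :=
  (hE.contDiffAt y hy).isSymmSndFDerivAt (by simpa using ENat.LEInfty.out) v w

theorem hess_nonneg (hE : IsMinkowskiEnergy E) {y : V} (hy : y ≠ 0) (v : V) :
    0 ≤ fderiv ℝ (fderiv ℝ E) y v v := by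
  rcases eq_or_ne v 0 with rfl | hv
  · simp
  · exact (hE.hess_pos y hy v hv).le

theorem hess_apply_self (hE : IsMinkowskiEnergy E) {y : V} (hy : y ≠ 0) (v : V) :
    fderiv ℝ (fderiv ℝ E) y v y = fderiv ℝ E y v := by
  rw [hE.hess_symm hy, hE.hess_self hy]

theorem pos (hE : IsMinkowskiEnergy E) {y : V} (hy : y ≠ 0) : 0 < E y := by
  have h := hE.hess_pos y hy y hy
  rw [hE.hess_self hy, hE.fderiv_apply_self hy] at h
  linarith

theorem fderiv_ne_zero (hE : IsMinkowskiEnergy E) {y : V} (hy : y ≠ 0) : fderiv ℝ E y ≠ 0 := by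
  intro h
  have hEuler := hE.fderiv_apply_self hy
  rw [h, zero_apply] at hEuler
  linarith [hE.pos hy]

theorem fderiv_apply_sub_lt_of_zero_notMem_segment (hE : IsMinkowskiEnergy E) {y₁ y₂ : V}
    (h : y₁ ≠ y₂) (h0 : 0 ∉ segment ℝ y₁ y₂) :
    fderiv ℝ E y₁ (y₂ - y₁) < fderiv ℝ E y₂ (y₂ - y₁) := by
  have hne : ∀ z ∈ segment ℝ y₁ y₂, z ≠ 0 := fun z hz hz0 => h0 (hz0 ▸ hz)
  have hderiv : ∀ z ∈ segment ℝ y₁ y₂, HasFDerivWithinAt (fun z => fderiv ℝ E z (y₂ - y₁))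
      ((fderiv ℝ (fderiv ℝ E) z).flip (y₂ - y₁)) (segment ℝ y₁ y₂) z := fun z hz => by
    have := (hE.hasFDerivAt_fderiv (hne z hz)).clm_apply (hasFDerivAt_const (y₂ - y₁) z)
    simpa using this.hasFDerivWithinAt
  obtain ⟨z, hz, hmv⟩ := domain_mvt hderiv (convex_segment y₁ y₂) (left_mem_segment ℝ y₁ y₂)
    (right_mem_segment ℝ y₁ y₂)
  rw [← sub_pos, hmv]
  exact hE.hess_pos z (hne z hz) _ (sub_ne_zero.2 h.symm)

theorem fderiv_apply_sub_lt_of_zero_mem_segment (hE : IsMinkowskiEnergy E) {y₁ y₂ : V}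
    (h₁ : y₁ ≠ 0) (h₂ : y₂ ≠ 0) (h0 : 0 ∈ segment ℝ y₁ y₂) :
    fderiv ℝ E y₁ (y₂ - y₁) < fderiv ℝ E y₂ (y₂ - y₁) := by
  rw [mem_segment_iff_sameRay, zero_sub, sub_zero] at h0
  obtain ⟨r, hr, hry⟩ := h0.exists_pos_left (neg_ne_zero.2 h₁) h₂
  have hy₂ : y₂ - y₁ = -(r + 1) • y₁ := by rw [← hry]; module
  have hy₁ : y₂ - y₁ = (1 + r⁻¹) • y₂ := by
    rw [← hry, smul_smul, add_mul, inv_mul_cancel₀ hr.ne']; module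
  calc fderiv ℝ E y₁ (y₂ - y₁) = -((r + 1) * (2 * E y₁)) := by
        rw [hy₂, map_smul, hE.fderiv_apply_self h₁, smul_eq_mul, neg_mul]
    _ < 0 := by have := hE.pos h₁; rw [neg_lt_zero]; positivity
    _ < (1 + r⁻¹) * (2 * E y₂) := by have := hE.pos h₂; positivity
    _ = fderiv ℝ E y₂ (y₂ - y₁) := by
        rw [hy₁, map_smul, hE.fderiv_apply_self h₂, smul_eq_mul]

theorem fderiv_apply_sub_lt (hE : IsMinkowskiEnergy E) {y₁ y₂ : V} (h₁ : y₁ ≠ 0) (h₂ : y₂ ≠ 0)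
    (h : y₁ ≠ y₂) : fderiv ℝ E y₁ (y₂ - y₁) < fderiv ℝ E y₂ (y₂ - y₁) := by
  by_cases h0 : (0 : V) ∈ segment ℝ y₁ y₂
  · exact hE.fderiv_apply_sub_lt_of_zero_mem_segment h₁ h₂ h0
  · exact hE.fderiv_apply_sub_lt_of_zero_notMem_segment h h0

theorem fderiv_injOn (hE : IsMinkowskiEnergy E) : InjOn (fderiv ℝ E) {0}ᶜ := by
  intro y₁ h₁ y₂ h₂ h
  by_contra hne
  exact (hE.fderiv_apply_sub_lt h₁ h₂ hne).ne (by rw [h])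

theorem sq_le_of_hess_eq (hE : IsMinkowskiEnergy E) {y : V} (hy : y ≠ 0) {α : V →L[ℝ] ℝ} {X : V}
    (hX : fderiv ℝ (fderiv ℝ E) y X = α) : α y ^ 2 ≤ 2 * E y * α X := by
  have h := bilin_sq_le (hE.hess_symm hy) (hE.hess_nonneg hy) X y
  rwa [hX, hE.hess_self hy, hE.fderiv_apply_self hy, mul_comm] at h

variable [FiniteDimensional ℝ V]

theorem exists_forall_mul_norm_sq_le (hE : IsMinkowskiEnergy E) :
    ∃ c, 0 < c ∧ ∀ y, y ≠ 0 → c * ‖y‖ ^ 2 ≤ E y := by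
  have hne : ∀ u ∈ Metric.sphere (0 : V) 1, u ≠ 0 := fun u hu =>
    ne_zero_of_mem_unit_sphere ⟨u, hu⟩
  obtain ⟨c, hc, hle⟩ := (isCompact_sphere (0 : V) 1).exists_forall_le'
    (fun u hu => (hE.hasFDerivAt (hne u hu)).continuousAt.continuousWithinAt)
    (fun u hu => hE.pos (hne u hu))
  refine ⟨c, hc, fun y hy => ?_⟩
  have hy' : 0 < ‖y‖ := norm_pos_iff.2 hy
  have hu := hle (‖y‖⁻¹ • y) (by simp [norm_smul, hy'.ne'])
  rwa [hE.homogeneous y _ (inv_pos.2 hy'), inv_pow, inv_mul_eq_div, le_div_iff₀ (by positivity)]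
    at hu

theorem exists_isMinOn_affine_hyperplane (hE : IsMinkowskiEnergy E) {θ : V →L[ℝ] ℝ}
    (hθ : θ ≠ 0) : ∃ y, θ y = 1 ∧ IsMinOn E {z | θ z = 1} y := by
  obtain ⟨y₀, hy₀⟩ : ∃ y, θ y = 1 :=
    LinearMap.surjective (f := θ.toLinearMap) (fun h => hθ (by exact_mod_cast h)) 1
  have hne : ∀ z, θ z = 1 → z ≠ 0 := by rintro z hz rfl; simp at hz
  obtain ⟨c, hc, hle⟩ := hE.exists_forall_mul_norm_sq_le
  have hlarge : Tendsto (fun y : V => c * ‖y‖ ^ 2) (cocompact V) atTop :=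
    ((tendsto_pow_atTop two_ne_zero).comp
      (tendsto_norm_cocompact_atTop (E := V))).const_mul_atTop hc
  obtain ⟨y, hy, hmin⟩ := ContinuousOn.exists_isMinOn' (s := {z | θ z = 1}) (f := E)
    (fun z hz => (hE.hasFDerivAt (hne z hz)).continuousAt.continuousWithinAt)
    (isClosed_eq θ.continuous continuous_const) hy₀
    (eventually_inf_principal.2 <| (hlarge.eventually_ge_atTop (E y₀)).mono fun z hz hz1 =>
      hz.trans (hle z (hne z hz1)))
  exact ⟨y, hy, hmin⟩

theorem exists_fderiv_eq (hE : IsMinkowskiEnergy E) {θ : V →L[ℝ] ℝ} (hθ : θ ≠ 0) :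
    ∃ y, y ≠ 0 ∧ fderiv ℝ E y = θ := by
  have : CompleteSpace V := FiniteDimensional.complete ℝ V
  obtain ⟨y, hy1, hmin⟩ := hE.exists_isMinOn_affine_hyperplane hθ
  have hy0 : y ≠ 0 := by rintro rfl; simp at hy1
  have hmin' : IsLocalExtrOn E {z | θ z = θ y} y := .inl <| by rw [hy1]; exact hmin.localize
  obtain ⟨a, b, hab, hmult⟩ := hmin'.exists_multipliers_of_hasStrictFDerivAt_1d
    θ.hasStrictFDerivAt ((hE.contDiffAt y hy0).hasStrictFDerivAt (by simp))
  have ha : a = -(b * (2 * E y)) := by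
    have := congrArg (fun η : V →L[ℝ] ℝ => η y) hmult
    simp only [add_apply, smul_apply, smul_eq_mul, hy1, hE.fderiv_apply_self hy0,
      zero_apply] at this
    linarith
  have hb : b ≠ 0 := by rintro rfl; exact hab (by simp [ha])
  have hEy := hE.pos hy0
  have hdE : fderiv ℝ E y = (2 * E y) • θ := by
    apply smul_right_injective _ hb
    have hsum : -((b * (2 * E y)) • θ) + b • fderiv ℝ E y = 0 := by
      rw [← hmult, ha]; module
    simpa only [smul_smul] using (neg_add_eq_zero.1 hsum).symm
  refine ⟨(2 * E y)⁻¹ • y, smul_ne_zero (by positivity) hy0, ?_⟩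
  rw [hE.fderiv_smul y (by positivity), hdE, inv_smul_smul₀ (by positivity)]

/-- The inverse of the Legendre transform `y ↦ dE(y)`, with value `0` at `0`. -/
noncomputable def legendreInv (hE : IsMinkowskiEnergy E) (θ : V →L[ℝ] ℝ) : V :=
  open Classical in
  if h : θ ≠ 0 then (hE.exists_fderiv_eq h).choose else 0

theorem legendreInv_ne_zero (hE : IsMinkowskiEnergy E) {θ : V →L[ℝ] ℝ} (hθ : θ ≠ 0) :
    hE.legendreInv θ ≠ 0 := by
  rw [legendreInv, dif_pos hθ]
  exact (hE.exists_fderiv_eq hθ).choose_spec.1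

theorem fderiv_legendreInv (hE : IsMinkowskiEnergy E) {θ : V →L[ℝ] ℝ} (hθ : θ ≠ 0) :
    fderiv ℝ E (hE.legendreInv θ) = θ := by
  rw [legendreInv, dif_pos hθ]
  exact (hE.exists_fderiv_eq hθ).choose_spec.2

theorem legendreInv_fderiv (hE : IsMinkowskiEnergy E) {y : V} (hy : y ≠ 0) :
    hE.legendreInv (fderiv ℝ E y) = y :=
  hE.fderiv_injOn (hE.legendreInv_ne_zero (hE.fderiv_ne_zero hy)) hy
    (hE.fderiv_legendreInv (hE.fderiv_ne_zero hy))

theorem hess_isInvertible (hE : IsMinkowskiEnergy E) {y : V} (hy : y ≠ 0) :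
    (fderiv ℝ (fderiv ℝ E) y).IsInvertible :=
  isInvertible_of_definite fun v hv => (hE.hess_pos y hy v hv).ne'

theorem contDiffAt_legendreInv (hE : IsMinkowskiEnergy E) {θ : V →L[ℝ] ℝ} (hθ : θ ≠ 0) :
    ContDiffAt ℝ ∞ hE.legendreInv θ := by
  have : CompleteSpace V := FiniteDimensional.complete ℝ V
  have hn : (∞ : WithTop ℕ∞) ≠ 0 := by simp
  have hy0 := hE.legendreInv_ne_zero hθ
  have hf := hE.contDiffAt_fderiv hy0
  obtain ⟨hess, hhess⟩ := hE.hess_isInvertible hy0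
  have hf' : HasFDerivAt (fderiv ℝ E) (hess : V →L[ℝ] (V →L[ℝ] ℝ)) (hE.legendreInv θ) :=
    hhess ▸ hE.hasFDerivAt_fderiv hy0
  have smooth_inv := hf.to_localInverse hf' hn
  have inv_apply := hf.localInverse_apply_image hf' hn
  have right_inv := (hf.hasStrictFDerivAt' hf' hn).eventually_right_inverse
  rw [hE.fderiv_legendreInv hθ] at smooth_inv inv_apply right_inv
  have inv_ne : ∀ᶠ η in 𝓝 θ, hf.localInverse hf' hn η ≠ 0 :=
    smooth_inv.continuousAt.eventually (by rw [inv_apply]; exact isOpen_ne.mem_nhds hy0)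
  refine smooth_inv.congr_of_eventuallyEq ?_
  filter_upwards [inv_ne, right_inv, isOpen_ne.mem_nhds hθ] with η hη0 hη hηθ
  exact hE.fderiv_injOn (hE.legendreInv_ne_zero hηθ) hη0
    ((hE.fderiv_legendreInv hηθ).trans hη.symm)

end IsMinkowskiEnergy

/-! ### One-variable calculus -/

section Calculus

theorem exists_tendsto_div_sq {ν : ℝ → ℝ} (hν : ContDiff ℝ 2 ν) (h0 : ν 0 = 0)
    (h1 : deriv ν 0 = 0) : ∃ b, Tendsto (fun t => ν t / t ^ 2) (𝓝[≠] 0) (𝓝 b) := by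
  have hd : Differentiable ℝ ν := hν.differentiable (by simp)
  have hdd : DifferentiableAt ℝ (deriv ν) 0 :=
    ((contDiff_succ_iff_deriv (n := 1)).1 hν).2.2.differentiable (by simp) 0
  have lim_num : Tendsto ν (𝓝[≠] 0) (𝓝 0) :=
    (h0 ▸ hd.continuous.tendsto 0).mono_left nhdsWithin_le_nhds
  have lim_den : Tendsto (fun t : ℝ => t ^ 2) (𝓝[≠] 0) (𝓝 0) :=
    ((continuous_pow 2).tendsto' 0 0 (by simp)).mono_left nhdsWithin_le_nhds
  refine ⟨deriv (deriv ν) 0 / 2, deriv.lhopital_zero_nhdsNE (Eventually.of_forall hd) ?_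
    lim_num lim_den ?_⟩
  · filter_upwards [self_mem_nhdsWithin] with t ht
    simpa using ht
  · refine (hdd.hasDerivAt.tendsto_slope_zero.div_const 2).congr fun t => ?_
    simp only [zero_add, h1, sub_zero, smul_eq_mul, deriv_pow_field, Nat.cast_ofNat,
      Nat.add_one_sub_one, pow_one]
    ring

theorem tendsto_inv_mul_sin : Tendsto (fun t : ℝ => t⁻¹ * Real.sin t) (𝓝[≠] 0) (𝓝 1) := by
  simpa using (Real.hasDerivAt_sin 0).tendsto_slope_zero

theorem exists_mem_Ioo_cos_eq_mul_sin (c : ℝ) :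
    ∃ φ ∈ Ioo 0 Real.pi, Real.cos φ = c * Real.sin φ := by
  refine ⟨Real.pi / 2 - Real.arctan c, ⟨?_, ?_⟩, ?_⟩
  · linarith [Real.arctan_lt_pi_div_two c]
  · linarith [Real.neg_pi_div_two_lt_arctan c]
  · rw [Real.cos_pi_div_two_sub, Real.sin_pi_div_two_sub,
      ← Real.tan_mul_cos (Real.cos_arctan_pos c).ne', Real.tan_arctan]

theorem mem_Icc_of_antitoneOn_of_tendsto {f : ℝ → ℝ} {a c l r : ℝ} (hf : AntitoneOn f (Ioo a c))
    (hl : Tendsto f (𝓝[>] a) (𝓝 l)) (hr : Tendsto f (𝓝[<] c) (𝓝 r)) {t : ℝ} (ht : t ∈ Ioo a c) :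
    f t ∈ Icc r l := by
  constructor
  · refine le_of_tendsto hr ?_
    filter_upwards [Ioo_mem_nhdsLT ht.2] with s hs
    exact hf ht ⟨ht.1.trans hs.1, hs.2⟩ hs.1.le
  · refine ge_of_tendsto hl ?_
    filter_upwards [Ioo_mem_nhdsGT ht.1] with s hs
    exact hf ⟨hs.1, hs.2.trans ht.2⟩ ht hs.2.le

theorem eq_of_antitoneOn_of_periodic {f : ℝ → ℝ} {a c T b b' : ℝ} (hT : Function.Periodic f T)
    (hc : c < a + T) (h₁ : AntitoneOn f (Ioo a c)) (h₂ : AntitoneOn f (Ioo c (a + T)))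
    (ha : Tendsto f (𝓝[≠] a) (𝓝 b)) (hb : Tendsto f (𝓝[≠] c) (𝓝 b')) {t : ℝ}
    (ht : t ∈ Ioo a c) : f t = b := by
  have haT : Tendsto f (𝓝[<] (a + T)) (𝓝 b) := by
    have hshift : Tendsto (· - T) (𝓝[<] (a + T)) (𝓝[≠] a) :=
      tendsto_nhdsWithin_of_tendsto_nhds_of_eventually_within _
        (((continuous_sub_right T).tendsto' _ _ (by ring)).mono_left nhdsWithin_le_nhds)
        (by filter_upwards [self_mem_nhdsWithin] with s hs using (sub_lt_iff_lt_add.2 hs).ne)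
    exact (ha.comp hshift).congr fun s => hT.sub_eq s
  have hle : b ≤ b' := by
    have := mem_Icc_of_antitoneOn_of_tendsto h₂ (hb.mono_left (nhdsGT_le_nhdsNE _)) haT
      (t := (c + (a + T)) / 2) ⟨by linarith, by linarith⟩
    exact this.1.trans this.2
  have := mem_Icc_of_antitoneOn_of_tendsto h₁ (ha.mono_left (nhdsGT_le_nhdsNE _))
    (hb.mono_left (nhdsLT_le_nhdsNE _)) ht
  exact this.2.antisymm (hle.trans this.1)

end Calculus

/-! ### Gradients with respect to the Hessian of a Minkowski energy -/

/-- The gradient of the linear form `α` with respect to the Riemannian metric given by the Hessian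
of `E`; the value is `0` where the Hessian is degenerate. -/
noncomputable def hessGradient {V : Type*} [NormedAddCommGroup V] [NormedSpace ℝ V] (E : V → ℝ)
    (α : V →L[ℝ] ℝ) (y : V) : V :=
  (fderiv ℝ (fderiv ℝ E) y).inverse α

namespace IsMinkowskiEnergy

variable {V : Type*} [NormedAddCommGroup V] [NormedSpace ℝ V] {E : V → ℝ}

theorem hessGradient_smul (hE : IsMinkowskiEnergy E) (α : V →L[ℝ] ℝ) (y : V) {t : ℝ} (ht : 0 < t) :
    hessGradient E α (t • y) = hessGradient E α y := by
  rw [hessGradient, hE.hess_smul y ht, hessGradient]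

theorem fderiv_hess_apply_comm (hE : IsMinkowskiEnergy E) {y : V} (hy : y ≠ 0) (u v w : V) :
    fderiv ℝ (fderiv ℝ (fderiv ℝ E)) y u v w = fderiv ℝ (fderiv ℝ (fderiv ℝ E)) y v u w := by
  rw [(hE.contDiffAt_fderiv hy).isSymmSndFDerivAt (by simpa using ENat.LEInfty.out) u v]

theorem fderiv_hess_apply_comm' (hE : IsMinkowskiEnergy E) {y : V} (hy : y ≠ 0) (u v w : V) :
    fderiv ℝ (fderiv ℝ (fderiv ℝ E)) y u v w = fderiv ℝ (fderiv ℝ (fderiv ℝ E)) y u w v := by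
  have hd : HasFDerivAt (fderiv ℝ (fderiv ℝ E)) (fderiv ℝ (fderiv ℝ (fderiv ℝ E)) y) y :=
    (((hE.contDiffAt_fderiv hy).fderiv_right (m := ∞) (by simp)).differentiableAt
      (by simp)).hasFDerivAt
  have hsymm : (fun z => fderiv ℝ (fderiv ℝ E) z v w) =ᶠ[𝓝 y]
      fun z => fderiv ℝ (fderiv ℝ E) z w v := by
    filter_upwards [isOpen_ne.mem_nhds hy] with z hz using hE.hess_symm hz v w
  have apply_hasFDerivAt (v w : V) := (hd.clm_apply (hasFDerivAt_const v y)).clm_apply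
    (hasFDerivAt_const w y)
  have := (apply_hasFDerivAt v w).unique ((apply_hasFDerivAt w v).congr_of_eventuallyEq hsymm)
  simpa using congrArg (fun θ : V →L[ℝ] ℝ => θ u) this

variable [FiniteDimensional ℝ V]

theorem hess_hessGradient (hE : IsMinkowskiEnergy E) (α : V →L[ℝ] ℝ) {y : V} (hy : y ≠ 0) :
    fderiv ℝ (fderiv ℝ E) y (hessGradient E α y) = α :=
  (hE.hess_isInvertible hy).self_apply_inverse α

theorem contDiffAt_inverse_hess (hE : IsMinkowskiEnergy E) {y : V} (hy : y ≠ 0) :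
    ContDiffAt ℝ ∞ (fun z => (fderiv ℝ (fderiv ℝ E) z).inverse) y := by
  have : CompleteSpace V := FiniteDimensional.complete ℝ V
  exact (hE.hess_isInvertible hy).contDiffAt_map_inverse.comp y
    ((hE.contDiffAt_fderiv hy).fderiv_right (by simp))

theorem contDiffAt_hessGradient (hE : IsMinkowskiEnergy E) (α : V →L[ℝ] ℝ) {y : V} (hy : y ≠ 0) :
    ContDiffAt ℝ ∞ (hessGradient E α) y :=
  (hE.contDiffAt_inverse_hess hy).clm_apply contDiffAt_const

theorem fderiv_hess_hessGradient (hE : IsMinkowskiEnergy E) (α : V →L[ℝ] ℝ) {y : V} (hy : y ≠ 0)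
    (v : V) : fderiv ℝ (fderiv ℝ (fderiv ℝ E)) y v (hessGradient E α y)
      = -fderiv ℝ (fderiv ℝ E) y (fderiv ℝ (hessGradient E α) y v) := by
  have hhess : DifferentiableAt ℝ (fderiv ℝ (fderiv ℝ E)) y :=
    ((hE.contDiffAt_fderiv hy).fderiv_right (m := ∞) (by simp)).differentiableAt (by simp)
  have hgrad := (hE.contDiffAt_hessGradient α hy).differentiableAt (by simp)
  have hconst : (fun z => fderiv ℝ (fderiv ℝ E) z (hessGradient E α z)) =ᶠ[𝓝 y] fun _ => α := by
    filter_upwards [isOpen_ne.mem_nhds hy] with z hz using hE.hess_hessGradient α hz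
  have := (hhess.hasFDerivAt.clm_apply hgrad.hasFDerivAt).unique
    ((hasFDerivAt_const α y).congr_of_eventuallyEq hconst)
  refine eq_neg_of_add_eq_zero_right ?_
  simpa using congrArg (fun θ : V →L[ℝ] V →L[ℝ] ℝ => θ v) this

theorem hess_fderiv_hessGradient_self (hE : IsMinkowskiEnergy E) (α : V →L[ℝ] ℝ) {y : V}
    (hy : y ≠ 0) : fderiv ℝ (fderiv ℝ E) y (fderiv ℝ (hessGradient E α) y (hessGradient E α y))
      = fderiv ℝ (fun z => α (hessGradient E α z)) y := by
  set X := hessGradient E α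
  have hX : HasFDerivAt (fun z => α (X z)) (α ∘L fderiv ℝ X y) y :=
    α.hasFDerivAt.comp y ((hE.contDiffAt_hessGradient α hy).differentiableAt (by simp)).hasFDerivAt
  ext v
  calc fderiv ℝ (fderiv ℝ E) y (fderiv ℝ X y (X y)) v
      = -fderiv ℝ (fderiv ℝ (fderiv ℝ E)) y (X y) (X y) v := by
        rw [hE.fderiv_hess_hessGradient α hy, neg_apply, neg_neg]
    _ = -fderiv ℝ (fderiv ℝ (fderiv ℝ E)) y v (X y) (X y) := by
        rw [hE.fderiv_hess_apply_comm' hy, hE.fderiv_hess_apply_comm hy]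
    _ = fderiv ℝ (fderiv ℝ E) y (X y) (fderiv ℝ X y v) := by
        rw [hE.fderiv_hess_hessGradient α hy, neg_apply, neg_neg, hE.hess_symm hy]
    _ = fderiv ℝ (fun z => α (X z)) y v := by
        rw [hE.hess_hessGradient α hy, hX.fderiv, ContinuousLinearMap.comp_apply]

end IsMinkowskiEnergy

/-! ### Linear forms whose gradient has quadratic norm -/

/-- `E` is a Minkowski energy, `α` a nonzero linear form, and `2 E |grad α|²` is the quadratic form
of `q`, where the gradient of `α` is taken with respect to the Hessian of `E`. -/
structure HasQuadraticGradient {V : Type*} [NormedAddCommGroup V] [NormedSpace ℝ V] (E : V → ℝ)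
    (α : V →L[ℝ] ℝ) (q : V →L[ℝ] V →L[ℝ] ℝ) : Prop where
  isMinkowskiEnergy : IsMinkowskiEnergy E
  ne_zero : α ≠ 0
  symm : ∀ v w, q v w = q w v
  two_mul_energy_mul : ∀ y, y ≠ 0 → ∀ X, fderiv ℝ (fderiv ℝ E) y X = α → 2 * E y * α X = q y y

namespace HasQuadraticGradient

variable {V : Type*} [NormedAddCommGroup V] [NormedSpace ℝ V]
  {E : V → ℝ} {α : V →L[ℝ] ℝ} {q : V →L[ℝ] V →L[ℝ] ℝ}

theorem neg (h : HasQuadraticGradient E α q) : HasQuadraticGradient E (-α) q where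
  isMinkowskiEnergy := h.isMinkowskiEnergy
  ne_zero := neg_ne_zero.2 h.ne_zero
  symm := h.symm
  two_mul_energy_mul y hy X hX := by
    simpa using h.two_mul_energy_mul y hy (-X) (by rw [map_neg, hX, neg_neg])

/-- The bilinear form `q - α ⊗ α`; its quadratic form is the defect `2 E |grad α|² - α²` in the
Cauchy-Schwarz inequality for `grad α` and the position vector. -/
noncomputable def defect (α : V →L[ℝ] ℝ) (q : V →L[ℝ] V →L[ℝ] ℝ) : V →L[ℝ] V →L[ℝ] ℝ :=
  q - α.smulRight α

theorem defect_apply (v w : V) : defect α q v w = q v w - α v * α w := by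
  simp [defect]

theorem apply_eq_smul_add_defect (α : V →L[ℝ] ℝ) (q : V →L[ℝ] V →L[ℝ] ℝ) (v : V) :
    q v = α v • α + defect α q v := by
  ext w
  simp [defect]

theorem defect_of_apply_eq_zero {m : V} (hαm : α m = 0) : defect α q m = q m := by
  rw [apply_eq_smul_add_defect α q, hαm, zero_smul, zero_add]

theorem defect_symm (h : HasQuadraticGradient E α q) (v w : V) :
    defect α q v w = defect α q w v := by
  rw [defect_apply, defect_apply, h.symm, mul_comm]

variable [FiniteDimensional ℝ V]

theorem pos (h : HasQuadraticGradient E α q) {y : V} (hy : y ≠ 0) : 0 < q y y := by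
  obtain ⟨X, hX⟩ := (h.isMinkowskiEnergy.hess_isInvertible hy).surjective α
  have hX0 : X ≠ 0 := fun h0 => h.ne_zero (by rw [← hX, h0, map_zero])
  have hαX := h.isMinkowskiEnergy.hess_pos y hy X hX0
  rw [hX] at hαX
  rw [← h.two_mul_energy_mul y hy X hX]
  have := h.isMinkowskiEnergy.pos hy
  positivity

theorem exists_apply_eq (h : HasQuadraticGradient E α q) (η : V →L[ℝ] ℝ) : ∃ m, q m = η :=
  (isInvertible_of_definite fun _ hv => (h.pos hv).ne').surjective η

theorem defect_nonneg (h : HasQuadraticGradient E α q) (y : V) : 0 ≤ defect α q y y := by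
  rcases eq_or_ne y 0 with rfl | hy
  · simp
  obtain ⟨X, hX⟩ := (h.isMinkowskiEnergy.hess_isInvertible hy).surjective α
  rw [defect_apply, ← h.two_mul_energy_mul y hy X hX, ← sq, sub_nonneg]
  exact h.isMinkowskiEnergy.sq_le_of_hess_eq hy hX

theorem sq_le_mul_defect (h : HasQuadraticGradient E α q) {m : V} (hαm : α m = 0) (y : V) :
    q m y ^ 2 ≤ q m m * defect α q y y := by
  have := bilin_sq_le h.defect_symm h.defect_nonneg m y
  rwa [defect_of_apply_eq_zero hαm] at this

theorem defect_eq_zero_of_fderiv_eq (h : HasQuadraticGradient E α q) {y : V} (hy : y ≠ 0) {c : ℝ}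
    (hc : c ≠ 0) (hyc : fderiv ℝ E y = c • α) : defect α q y = 0 := by
  apply bilin_eq_zero_of_apply_self h.defect_symm h.defect_nonneg
  have hgrad : fderiv ℝ (fderiv ℝ E) y (c⁻¹ • y) = α := by
    rw [map_smul, h.isMinkowskiEnergy.hess_self hy, hyc, inv_smul_smul₀ hc]
  have hEuler := h.isMinkowskiEnergy.fderiv_apply_self hy
  rw [hyc] at hEuler
  rw [defect_apply, ← h.two_mul_energy_mul y hy _ hgrad, ← hEuler]
  simp only [smul_apply, map_smul, smul_eq_mul]
  field_simp
  ring

/-- For `c ≠ 0` this is the strict monotonicity of the Legendre transform between `y` and the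
vector `y₀` with `dE(y₀) = c α`, on which `q m` vanishes. -/
theorem mul_apply_pos (h : HasQuadraticGradient E α q) {m y : V} (hm : m ≠ 0) (hαm : α m = 0)
    (hy : y ≠ 0) {c s : ℝ} (hs : s ≠ 0) (hyc : fderiv ℝ E y = c • α + s • q m) :
    0 < s * q m y := by
  have hE := h.isMinkowskiEnergy
  rcases eq_or_ne c 0 with rfl | hc
  · have hEuler := hE.fderiv_apply_self hy
    rw [hyc, zero_smul, zero_add, smul_apply, smul_eq_mul] at hEuler
    linarith [hE.pos hy]
  · obtain ⟨y₀, hy₀, hy₀c⟩ := hE.exists_fderiv_eq (smul_ne_zero hc h.ne_zero)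
    have hqy₀ : q m y₀ = 0 := by
      rw [← defect_of_apply_eq_zero hαm, h.defect_symm,
        h.defect_eq_zero_of_fderiv_eq hy₀ hc hy₀c, zero_apply]
    have hne : y₀ ≠ y := by
      rintro rfl
      have hsq : s • q m = 0 := by simpa [hy₀c] using hyc
      have := congrArg (fun η : V →L[ℝ] ℝ => η m) hsq
      simp [hs, (h.pos hm).ne'] at this
    have hlt := hE.fderiv_apply_sub_lt hy₀ hy hne
    rwa [hyc, hy₀c, add_apply, lt_add_iff_pos_right, smul_apply, map_sub, hqy₀, sub_zero,
      smul_eq_mul] at hlt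

/-! ### The curve over the ellipse spanned by two covectors -/

theorem cos_smul_add_sin_smul_ne_zero (h : HasQuadraticGradient E α q) {m : V} (hm : m ≠ 0)
    (hαm : α m = 0) (φ : ℝ) : Real.cos φ • α + Real.sin φ • q m ≠ 0 := by
  intro h0
  have hsin : Real.sin φ = 0 := by
    have := congrArg (fun η : V →L[ℝ] ℝ => η m) h0
    simpa [hαm, (h.pos hm).ne'] using this
  have hcos : Real.cos φ = 0 := by simpa [hsin, h.ne_zero] using h0
  simpa [hsin, hcos] using Real.sin_sq_add_cos_sq φ

/-- The curve whose Legendre transform runs through the ellipse `cos φ • α + sin φ • q m`. -/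
noncomputable def curve (h : HasQuadraticGradient E α q) (m : V) (φ : ℝ) : V :=
  h.isMinkowskiEnergy.legendreInv (Real.cos φ • α + Real.sin φ • q m)

theorem curve_ne_zero (h : HasQuadraticGradient E α q) {m : V} (hm : m ≠ 0) (hαm : α m = 0)
    (φ : ℝ) : h.curve m φ ≠ 0 :=
  h.isMinkowskiEnergy.legendreInv_ne_zero (h.cos_smul_add_sin_smul_ne_zero hm hαm φ)

theorem fderiv_curve (h : HasQuadraticGradient E α q) {m : V} (hm : m ≠ 0) (hαm : α m = 0)
    (φ : ℝ) : fderiv ℝ E (h.curve m φ) = Real.cos φ • α + Real.sin φ • q m :=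
  h.isMinkowskiEnergy.fderiv_legendreInv (h.cos_smul_add_sin_smul_ne_zero hm hαm φ)

theorem contDiff_curve (h : HasQuadraticGradient E α q) {m : V} (hm : m ≠ 0) (hαm : α m = 0) :
    ContDiff ℝ ∞ (h.curve m) :=
  contDiff_iff_contDiffAt.2 fun φ =>
    (h.isMinkowskiEnergy.contDiffAt_legendreInv
      (h.cos_smul_add_sin_smul_ne_zero hm hαm φ)).comp φ
      ((Real.contDiff_cos.smul contDiff_const).add
        (Real.contDiff_sin.smul contDiff_const)).contDiffAt

theorem hasDerivAt_curve (h : HasQuadraticGradient E α q) {m : V} (hm : m ≠ 0) (hαm : α m = 0)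
    (φ : ℝ) : HasDerivAt (h.curve m) (deriv (h.curve m) φ) φ :=
  ((h.contDiff_curve hm hαm).differentiable (by simp) φ).hasDerivAt

theorem hasDerivAt_apply_curve (h : HasQuadraticGradient E α q) {m : V} (hm : m ≠ 0)
    (hαm : α m = 0) (η : V →L[ℝ] ℝ) (φ : ℝ) :
    HasDerivAt (fun φ => η (h.curve m φ)) (η (deriv (h.curve m) φ)) φ :=
  η.hasFDerivAt.comp_hasDerivAt φ (h.hasDerivAt_curve hm hαm φ)

theorem hess_deriv_curve (h : HasQuadraticGradient E α q) {m : V} (hm : m ≠ 0) (hαm : α m = 0)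
    (φ : ℝ) : fderiv ℝ (fderiv ℝ E) (h.curve m φ) (deriv (h.curve m) φ)
      = -Real.sin φ • α + Real.cos φ • q m := by
  have along_curve := (h.isMinkowskiEnergy.hasFDerivAt_fderiv
    (h.curve_ne_zero hm hαm φ)).comp_hasDerivAt φ (h.hasDerivAt_curve hm hαm φ)
  have ellipse : HasDerivAt (fun φ => Real.cos φ • α + Real.sin φ • q m)
      (-Real.sin φ • α + Real.cos φ • q m) φ :=
    ((Real.hasDerivAt_cos φ).smul_const α).add ((Real.hasDerivAt_sin φ).smul_const (q m))
  exact along_curve.unique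
    (ellipse.congr_of_eventuallyEq (Eventually.of_forall (h.fderiv_curve hm hαm)))

theorem two_mul_energy_curve (h : HasQuadraticGradient E α q) {m : V} (hm : m ≠ 0)
    (hαm : α m = 0) (φ : ℝ) : 2 * E (h.curve m φ)
      = Real.cos φ * α (h.curve m φ) + Real.sin φ * q m (h.curve m φ) := by
  rw [← h.isMinkowskiEnergy.fderiv_apply_self (h.curve_ne_zero hm hαm φ), h.fderiv_curve hm hαm]
  simp

theorem cos_mul_add_sin_mul_deriv_curve (h : HasQuadraticGradient E α q) {m : V} (hm : m ≠ 0)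
    (hαm : α m = 0) (φ : ℝ) :
    Real.cos φ * α (deriv (h.curve m) φ) + Real.sin φ * q m (deriv (h.curve m) φ)
      = -Real.sin φ * α (h.curve m φ) + Real.cos φ * q m (h.curve m φ) := by
  have hess := h.isMinkowskiEnergy.hess_apply_self (h.curve_ne_zero hm hαm φ)
    (deriv (h.curve m) φ)
  rw [h.hess_deriv_curve hm hαm, h.fderiv_curve hm hαm] at hess
  simpa only [add_apply, smul_apply, smul_eq_mul] using hess.symm

theorem defect_curve (h : HasQuadraticGradient E α q) {m : V} (hm : m ≠ 0) (hαm : α m = 0)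
    (φ : ℝ) : defect α q (h.curve m φ) (h.curve m φ) = Real.sin φ ^ 2 *
      (α (h.curve m φ) * q m (deriv (h.curve m) φ)
        - α (deriv (h.curve m) φ) * q m (h.curve m φ)) := by
  have hcs := Real.sin_sq_add_cos_sq φ
  have hy := h.curve_ne_zero hm hαm φ
  have hgrad : fderiv ℝ (fderiv ℝ E) (h.curve m φ)
      (Real.cos φ • h.curve m φ - Real.sin φ • deriv (h.curve m) φ) = α := by
    rw [map_sub, map_smul, map_smul, h.isMinkowskiEnergy.hess_self hy, h.fderiv_curve hm hαm,
      h.hess_deriv_curve hm hαm]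
    calc _ = (Real.sin φ ^ 2 + Real.cos φ ^ 2) • α := by module
      _ = α := by rw [hcs, one_smul]
  rw [defect_apply, ← h.two_mul_energy_mul _ hy _ hgrad, h.two_mul_energy_curve hm hαm]
  have hrel := h.cos_mul_add_sin_mul_deriv_curve hm hαm φ
  simp only [map_sub, map_smul, smul_eq_mul]
  linear_combination (-Real.sin φ * α (h.curve m φ)) * hrel + α (h.curve m φ) ^ 2 * hcs

theorem curve_neg (h : HasQuadraticGradient E α q) (m : V) (φ : ℝ) :
    h.neg.curve (-m) φ = h.curve m (φ + Real.pi) := by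
  rw [curve, curve, Real.cos_add_pi, Real.sin_add_pi, map_neg]
  congr 1
  module

theorem curve_add_two_pi (h : HasQuadraticGradient E α q) (m : V) (φ : ℝ) :
    h.curve m (φ + 2 * Real.pi) = h.curve m φ := by
  simp only [curve, Real.cos_add_two_pi, Real.sin_add_two_pi]

/-! ### The Hessian at the pole -/

/-- The vector whose Legendre transform is `α`. -/
noncomputable def pole (h : HasQuadraticGradient E α q) : V := h.isMinkowskiEnergy.legendreInv α

theorem pole_ne_zero (h : HasQuadraticGradient E α q) : h.pole ≠ 0 :=
  h.isMinkowskiEnergy.legendreInv_ne_zero h.ne_zero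

theorem fderiv_pole (h : HasQuadraticGradient E α q) : fderiv ℝ E h.pole = α :=
  h.isMinkowskiEnergy.fderiv_legendreInv h.ne_zero

theorem apply_pole_pos (h : HasQuadraticGradient E α q) : 0 < α h.pole := by
  have hEuler := h.isMinkowskiEnergy.fderiv_apply_self h.pole_ne_zero
  rw [h.fderiv_pole] at hEuler
  linarith [h.isMinkowskiEnergy.pos h.pole_ne_zero]

theorem defect_pole (h : HasQuadraticGradient E α q) : defect α q h.pole = 0 :=
  h.defect_eq_zero_of_fderiv_eq h.pole_ne_zero one_ne_zero (by rw [h.fderiv_pole, one_smul])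

theorem apply_pole (h : HasQuadraticGradient E α q) : q h.pole = α h.pole • α := by
  rw [apply_eq_smul_add_defect α q, h.defect_pole, add_zero]

theorem apply_pole_eq_zero_iff (h : HasQuadraticGradient E α q) {m : V} :
    q m h.pole = 0 ↔ α m = 0 := by
  simp [h.symm m, h.apply_pole, h.apply_pole_pos.ne']

theorem curve_zero (h : HasQuadraticGradient E α q) (m : V) : h.curve m 0 = h.pole := by
  simp [curve, pole]

theorem hess_pole_deriv_curve_zero (h : HasQuadraticGradient E α q) {m : V} (hm : m ≠ 0)
    (hαm : α m = 0) : fderiv ℝ (fderiv ℝ E) h.pole (deriv (h.curve m) 0) = q m := by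
  simpa [h.curve_zero] using h.hess_deriv_curve hm hαm 0

theorem defect_sub_pole (h : HasQuadraticGradient E α q) (v : V) :
    defect α q (v - h.pole) (v - h.pole) = defect α q v v := by
  simp [h.defect_symm v, h.defect_pole]

/-- Both sides are the limit of `defect α q (y t) (y t) / t ^ 2` at `0` along the curve `y`. -/
theorem defect_deriv_curve_zero (h : HasQuadraticGradient E α q) {m : V} (hm : m ≠ 0)
    (hαm : α m = 0) : defect α q (deriv (h.curve m) 0) (deriv (h.curve m) 0)
      = α h.pole * q m (deriv (h.curve m) 0) := by
  set y := h.curve m with hy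
  have hslope : Tendsto (fun t : ℝ => t⁻¹ • (y t - h.pole)) (𝓝[≠] 0) (𝓝 (deriv y 0)) := by
    simpa only [zero_add, hy, h.curve_zero] using (h.hasDerivAt_curve hm hαm 0).tendsto_slope_zero
  have lim_slope : Tendsto (fun t : ℝ => defect α q (t⁻¹ • (y t - h.pole)) (t⁻¹ • (y t - h.pole)))
      (𝓝[≠] 0) (𝓝 (defect α q (deriv y 0) (deriv y 0))) := by
    have hc : Continuous fun v => defect α q v v := by fun_prop
    exact (hc.tendsto _).comp hslope
  have lim_formula : Tendsto (fun t : ℝ => (t⁻¹ * Real.sin t) ^ 2 *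
      (α (y t) * q m (deriv y t) - α (deriv y t) * q m (y t))) (𝓝[≠] 0)
      (𝓝 (1 ^ 2 * (α (y 0) * q m (deriv y 0) - α (deriv y 0) * q m (y 0)))) := by
    have hyc : Continuous y := (h.contDiff_curve hm hαm).continuous
    have hdc : Continuous (deriv y) :=
      (contDiff_infty_iff_deriv.1 (h.contDiff_curve hm hαm)).2.continuous
    have hc : Continuous fun t => α (y t) * q m (deriv y t) - α (deriv y t) * q m (y t) := by
      fun_prop
    exact (tendsto_inv_mul_sin.pow 2).mul ((hc.tendsto 0).mono_left nhdsWithin_le_nhds)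
  have hEq : ∀ t : ℝ, defect α q (t⁻¹ • (y t - h.pole)) (t⁻¹ • (y t - h.pole))
      = (t⁻¹ * Real.sin t) ^ 2 * (α (y t) * q m (deriv y t) - α (deriv y t) * q m (y t)) := by
    intro t
    rw [map_smul, map_smul, smul_apply, h.defect_sub_pole, h.defect_curve hm hαm]
    simp only [smul_eq_mul]
    ring
  rw [tendsto_nhds_unique (lim_slope.congr hEq) lim_formula, show y 0 = h.pole from h.curve_zero m,
    h.apply_pole_eq_zero_iff.2 hαm]
  ring

theorem apply_self_eq_mul_hess_pole (h : HasQuadraticGradient E α q) {v : V} (hv : α v = 0) :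
    q v v = α h.pole * fderiv ℝ (fderiv ℝ E) h.pole v v := by
  rcases eq_or_ne v 0 with rfl | hv0
  · simp
  obtain ⟨m, hm⟩ := h.exists_apply_eq (fderiv ℝ (fderiv ℝ E) h.pole v)
  have hαm : α m = 0 := by
    rw [← h.apply_pole_eq_zero_iff, hm, h.isMinkowskiEnergy.hess_apply_self h.pole_ne_zero,
      h.fderiv_pole, hv]
  have hm0 : m ≠ 0 := by
    rintro rfl
    have := h.isMinkowskiEnergy.hess_pos _ h.pole_ne_zero v hv0
    simp [← hm] at this
  have hd : deriv (h.curve m) 0 = v :=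
    (h.isMinkowskiEnergy.hess_isInvertible h.pole_ne_zero).injective
      ((h.hess_pole_deriv_curve_zero hm0 hαm).trans hm)
  have := h.defect_deriv_curve_zero hm0 hαm
  rwa [hd, defect_of_apply_eq_zero hv, hm] at this

theorem apply_eq_mul_hess_pole (h : HasQuadraticGradient E α q) {v w : V} (hv : α v = 0)
    (hw : α w = 0) : q v w = α h.pole * fderiv ℝ (fderiv ℝ E) h.pole v w := by
  have hvw := h.apply_self_eq_mul_hess_pole (v := v + w) (by rw [map_add, hv, hw, add_zero])
  simp only [map_add, add_apply] at hvw
  rw [h.symm w v, h.isMinkowskiEnergy.hess_symm h.pole_ne_zero w v] at hvw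
  linarith [h.apply_self_eq_mul_hess_pole hv, h.apply_self_eq_mul_hess_pole hw]

theorem deriv_curve_zero (h : HasQuadraticGradient E α q) {m : V} (hm : m ≠ 0)
    (hαm : α m = 0) : deriv (h.curve m) 0 = α h.pole • m := by
  set v := deriv (h.curve m) 0
  have hess : fderiv ℝ (fderiv ℝ E) h.pole v = q m := h.hess_pole_deriv_curve_zero hm hαm
  have hv : α v = 0 := by
    rw [← h.fderiv_pole, ← h.isMinkowskiEnergy.hess_apply_self h.pole_ne_zero, hess,
      h.apply_pole_eq_zero_iff, hαm]
  have hw : α (v - α h.pole • m) = 0 := by simp [hv, hαm]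
  have hself : q (v - α h.pole • m) (v - α h.pole • m) = 0 := by
    rw [map_sub q, map_smul q, sub_apply, smul_apply, h.apply_eq_mul_hess_pole hv hw, hess,
      smul_eq_mul, sub_self]
  by_contra hne
  exact (h.pos (sub_ne_zero.2 hne)).ne' hself

/-! ### Rigidity along the curve -/

/-- The function `q m m * (α / q m) - cot φ` along the curve; it is monotone by the Cauchy-Schwarz
inequality for the defect, and constant only in the case of equality. -/
noncomputable def cotGap (h : HasQuadraticGradient E α q) (m : V) (φ : ℝ) : ℝ :=
  q m m * (α (h.curve m φ) / q m (h.curve m φ)) - Real.cos φ / Real.sin φ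

theorem sin_mul_apply_curve_pos (h : HasQuadraticGradient E α q) {m : V} (hm : m ≠ 0)
    (hαm : α m = 0) {φ : ℝ} (hφ : Real.sin φ ≠ 0) : 0 < Real.sin φ * q m (h.curve m φ) :=
  h.mul_apply_pos hm hαm (h.curve_ne_zero hm hαm φ) hφ (h.fderiv_curve hm hαm φ)

theorem apply_curve_ne_zero (h : HasQuadraticGradient E α q) {m : V} (hm : m ≠ 0)
    (hαm : α m = 0) {φ : ℝ} (hφ : Real.sin φ ≠ 0) : q m (h.curve m φ) ≠ 0 :=
  right_ne_zero_of_mul (h.sin_mul_apply_curve_pos hm hαm hφ).ne'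

theorem hasDerivAt_cotGap (h : HasQuadraticGradient E α q) {m : V} (hm : m ≠ 0) (hαm : α m = 0)
    {φ : ℝ} (hφ : Real.sin φ ≠ 0) : HasDerivAt (h.cotGap m)
      ((q m (h.curve m φ) ^ 2 - q m m * defect α q (h.curve m φ) (h.curve m φ))
        / (Real.sin φ ^ 2 * q m (h.curve m φ) ^ 2)) φ := by
  have hk := h.apply_curve_ne_zero hm hαm hφ
  have quotient := ((h.hasDerivAt_apply_curve hm hαm α φ).div
    (h.hasDerivAt_apply_curve hm hαm (q m) φ) hk).const_mul (q m m)
  have cot := (Real.hasDerivAt_cos φ).div (Real.hasDerivAt_sin φ) hφ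
  refine (quotient.sub cot).congr_deriv ?_
  rw [h.defect_curve hm hαm]
  field_simp
  linear_combination (q m (h.curve m φ) ^ 2) * Real.sin_sq_add_cos_sq φ

theorem antitoneOn_cotGap (h : HasQuadraticGradient E α q) {m : V} (hm : m ≠ 0) (hαm : α m = 0)
    {s : Set ℝ} (hs : Convex ℝ s) (hsin : ∀ φ ∈ s, Real.sin φ ≠ 0) :
    AntitoneOn (h.cotGap m) s := by
  refine antitoneOn_of_hasDerivWithinAt_nonpos hs
    (fun φ hφ => (h.hasDerivAt_cotGap hm hαm (hsin φ hφ)).continuousAt.continuousWithinAt)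
    (fun φ hφ => (h.hasDerivAt_cotGap hm hαm (hsin φ (interior_subset hφ))).hasDerivWithinAt)
    fun φ _ => div_nonpos_of_nonpos_of_nonneg ?_ (by positivity)
  exact sub_nonpos.2 (h.sq_le_mul_defect hαm _)

theorem cotGap_neg (h : HasQuadraticGradient E α q) (m : V) (φ : ℝ) :
    h.neg.cotGap (-m) φ = h.cotGap m (φ + Real.pi) := by
  simp [cotGap, h.curve_neg, Real.cos_add_pi, Real.sin_add_pi, neg_div_neg_eq]

theorem cotGap_periodic (h : HasQuadraticGradient E α q) (m : V) :
    Function.Periodic (h.cotGap m) (2 * Real.pi) := fun φ => by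
  simp only [cotGap, h.curve_add_two_pi, Real.cos_add_two_pi, Real.sin_add_two_pi]

theorem cotGap_eq_div (h : HasQuadraticGradient E α q) {m : V} (hm : m ≠ 0) (hαm : α m = 0)
    {φ : ℝ} (hφ : Real.sin φ ≠ 0) : h.cotGap m φ =
      (q m m * (α (h.curve m φ) * Real.sin φ) - Real.cos φ * q m (h.curve m φ))
        / (Real.sin φ * q m (h.curve m φ)) := by
  have := h.apply_curve_ne_zero hm hαm hφ
  rw [cotGap]
  field_simp

theorem exists_tendsto_cotGap_numerator (h : HasQuadraticGradient E α q) {m : V} (hm : m ≠ 0)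
    (hαm : α m = 0) : ∃ b, Tendsto (fun t => (q m m * (α (h.curve m t) * Real.sin t)
      - Real.cos t * q m (h.curve m t)) / t ^ 2) (𝓝[≠] 0) (𝓝 b) := by
  have smooth (η : V →L[ℝ] ℝ) : ContDiff ℝ 2 fun t => η (h.curve m t) :=
    η.contDiff.comp ((h.contDiff_curve hm hαm).of_le (by simpa using ENat.LEInfty.out))
  refine exists_tendsto_div_sq ((contDiff_const.mul ((smooth α).mul Real.contDiff_sin)).sub
    (Real.contDiff_cos.mul (smooth (q m)))) ?_ ?_
  · simp [h.curve_zero, h.apply_pole_eq_zero_iff, hαm]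
  · have hderiv := (((h.hasDerivAt_apply_curve hm hαm α 0).mul
      (Real.hasDerivAt_sin 0)).const_mul (q m m)).sub
      ((Real.hasDerivAt_cos 0).mul (h.hasDerivAt_apply_curve hm hαm (q m) 0))
    refine hderiv.deriv.trans ?_
    rw [h.deriv_curve_zero hm hαm, h.curve_zero, h.apply_pole_eq_zero_iff.2 hαm]
    simp only [Real.sin_zero, Real.cos_zero, map_smul, smul_eq_mul]
    ring

theorem tendsto_inv_mul_apply_curve (h : HasQuadraticGradient E α q) {m : V} (hm : m ≠ 0)
    (hαm : α m = 0) :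
    Tendsto (fun t : ℝ => t⁻¹ * q m (h.curve m t)) (𝓝[≠] 0) (𝓝 (α h.pole * q m m)) := by
  simpa [h.deriv_curve_zero hm hαm, h.curve_zero, h.apply_pole_eq_zero_iff.2 hαm]
    using (h.hasDerivAt_apply_curve hm hαm (q m) 0).tendsto_slope_zero

theorem exists_tendsto_cotGap_zero (h : HasQuadraticGradient E α q) {m : V} (hm : m ≠ 0)
    (hαm : α m = 0) : ∃ b, Tendsto (h.cotGap m) (𝓝[≠] 0) (𝓝 b) := by
  obtain ⟨b, hb⟩ := h.exists_tendsto_cotGap_numerator hm hαm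
  have hne : 1 * (α h.pole * q m m) ≠ 0 := by
    have := h.apply_pole_pos; have := h.pos hm; positivity
  have hden := tendsto_inv_mul_sin.mul (h.tendsto_inv_mul_apply_curve hm hαm)
  refine ⟨_, (hb.div hden hne).congr' ?_⟩
  filter_upwards [tendsto_inv_mul_sin.eventually_ne one_ne_zero, self_mem_nhdsWithin] with t ht ht0
  have ht0 : t ≠ 0 := ht0
  have hsin : Real.sin t ≠ 0 := right_ne_zero_of_mul ht
  have := h.apply_curve_ne_zero hm hαm hsin
  rw [h.cotGap_eq_div hm hαm hsin, Pi.div_apply]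
  field_simp

theorem exists_tendsto_cotGap_pi (h : HasQuadraticGradient E α q) {m : V} (hm : m ≠ 0)
    (hαm : α m = 0) : ∃ b, Tendsto (h.cotGap m) (𝓝[≠] Real.pi) (𝓝 b) := by
  obtain ⟨b, hb⟩ := h.neg.exists_tendsto_cotGap_zero (neg_ne_zero.2 hm) (by simpa using hαm)
  have hshift : Tendsto (· - Real.pi) (𝓝[≠] Real.pi) (𝓝[≠] 0) :=
    tendsto_nhdsWithin_of_tendsto_nhds_of_eventually_within _
      (((continuous_sub_right Real.pi).tendsto' _ _ (sub_self _)).mono_left nhdsWithin_le_nhds)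
      (by filter_upwards [self_mem_nhdsWithin] with t ht using sub_ne_zero.2 ht)
  exact ⟨b, (hb.comp hshift).congr fun t => by simp [h.cotGap_neg]⟩

theorem exists_eqOn_cotGap (h : HasQuadraticGradient E α q) {m : V} (hm : m ≠ 0)
    (hαm : α m = 0) : ∃ b, EqOn (h.cotGap m) (fun _ => b) (Ioo 0 Real.pi) := by
  obtain ⟨b, hb⟩ := h.exists_tendsto_cotGap_zero hm hαm
  obtain ⟨b', hb'⟩ := h.exists_tendsto_cotGap_pi hm hαm
  have hpi := Real.pi_pos
  refine ⟨b, fun φ hφ => eq_of_antitoneOn_of_periodic (h.cotGap_periodic m) (by linarith)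
    (h.antitoneOn_cotGap hm hαm (convex_Ioo _ _) fun ψ hψ => ?_)
    (h.antitoneOn_cotGap hm hαm (convex_Ioo _ _) fun ψ hψ => ?_) hb hb' hφ⟩
  · exact (Real.sin_pos_of_mem_Ioo hψ).ne'
  · rw [← Real.sin_sub_two_pi]
    exact (Real.sin_neg_of_neg_of_neg_pi_lt (by linarith [hψ.2]) (by linarith [hψ.1])).ne

theorem sq_eq_mul_defect_curve (h : HasQuadraticGradient E α q) {m : V} (hm : m ≠ 0)
    (hαm : α m = 0) {φ : ℝ} (hφ : φ ∈ Ioo 0 Real.pi) :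
    q m (h.curve m φ) ^ 2 = q m m * defect α q (h.curve m φ) (h.curve m φ) := by
  obtain ⟨b, hb⟩ := h.exists_eqOn_cotGap hm hαm
  have hsin := (Real.sin_pos_of_mem_Ioo hφ).ne'
  have hk := h.apply_curve_ne_zero hm hαm hsin
  have hderiv := (h.hasDerivAt_cotGap hm hαm hsin).unique
    ((hasDerivAt_const φ b).congr_of_eventuallyEq (hb.eventuallyEq_of_mem (Ioo_mem_nhds hφ.1 hφ.2)))
  rw [div_eq_zero_iff, or_iff_left (by positivity)] at hderiv
  exact sub_eq_zero.1 hderiv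

theorem exists_defect_curve_eq_smul (h : HasQuadraticGradient E α q) {m : V} (hm : m ≠ 0)
    (hαm : α m = 0) {φ : ℝ} (hφ : φ ∈ Ioo 0 Real.pi) :
    ∃ d : ℝ, defect α q (h.curve m φ) = d • q m := by
  have hdm : defect α q m = q m := defect_of_apply_eq_zero hαm
  refine ⟨_, (bilin_eq_smul_of_sq_eq h.defect_symm h.defect_nonneg (v := m) ?_ ?_).trans
    (by rw [hdm])⟩
  · rw [hdm]; exact (h.pos hm).ne'
  · rw [hdm]; exact h.sq_eq_mul_defect_curve hm hαm hφ

theorem exists_smul_eq_curve (h : HasQuadraticGradient E α q) {m y : V} (hy : y ≠ 0) {c : ℝ}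
    (hyc : fderiv ℝ E y = c • α + q m) : ∃ r : ℝ, r ≠ 0 ∧ ∃ φ ∈ Ioo 0 Real.pi,
      r • y = h.curve m φ := by
  obtain ⟨φ, hφ, hcos⟩ := exists_mem_Ioo_cos_eq_mul_sin c
  have hsin := Real.sin_pos_of_mem_Ioo hφ
  refine ⟨Real.sin φ, hsin.ne', φ, hφ, ?_⟩
  have hd : fderiv ℝ E (Real.sin φ • y) = Real.cos φ • α + Real.sin φ • q m := by
    rw [h.isMinkowskiEnergy.fderiv_smul y hsin, hyc, hcos]
    module
  rw [curve, ← hd, h.isMinkowskiEnergy.legendreInv_fderiv (smul_ne_zero hsin.ne' hy)]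

theorem exists_eq_smul_add (h : HasQuadraticGradient E α q) (θ : V →L[ℝ] ℝ) :
    ∃ (c : ℝ) (m : V), α m = 0 ∧ θ = c • α + q m := by
  obtain ⟨m, hm⟩ := h.exists_apply_eq (θ - (θ h.pole / α h.pole) • α)
  refine ⟨θ h.pole / α h.pole, m, ?_, by rw [hm]; abel⟩
  rw [← h.apply_pole_eq_zero_iff, hm, sub_apply, smul_apply, smul_eq_mul,
    div_mul_cancel₀ _ h.apply_pole_pos.ne', sub_self]

theorem exists_apply_eq_smul_add_smul (h : HasQuadraticGradient E α q) {y : V} (hy : y ≠ 0) :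
    ∃ a b : ℝ, q y = a • α + b • fderiv ℝ E y := by
  obtain ⟨c, m, hαm, hyc⟩ := h.exists_eq_smul_add (fderiv ℝ E y)
  suffices ∃ d : ℝ, defect α q y = d • q m by
    obtain ⟨d, hd⟩ := this
    refine ⟨α y - d * c, d, ?_⟩
    rw [apply_eq_smul_add_defect α q, hd, hyc]
    module
  rcases eq_or_ne m 0 with rfl | hm
  · rw [map_zero, add_zero] at hyc
    have hc : c ≠ 0 := by
      rintro rfl
      exact h.isMinkowskiEnergy.fderiv_ne_zero hy (hyc.trans (zero_smul ℝ α))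
    exact ⟨0, by rw [h.defect_eq_zero_of_fderiv_eq hy hc hyc, zero_smul]⟩
  · obtain ⟨r, hr, φ, hφ, hry⟩ := h.exists_smul_eq_curve hy hyc
    obtain ⟨d, hd⟩ := h.exists_defect_curve_eq_smul hm hαm hφ
    refine ⟨r⁻¹ * d, ?_⟩
    rw [← inv_smul_smul₀ hr y, hry, map_smul, hd, smul_smul]

theorem apply_hessGradient_smul_fderiv_add (h : HasQuadraticGradient E α q) {y : V} (hy : y ≠ 0) :
    α (hessGradient E α y) • fderiv ℝ E y + E y • fderiv ℝ (fun z => α (hessGradient E α z)) y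
      = q y := by
  have hE := h.isMinkowskiEnergy
  have grad : DifferentiableAt ℝ (fun z => α (hessGradient E α z)) y :=
    α.differentiableAt.comp y ((hE.contDiffAt_hessGradient α hy).differentiableAt (by simp))
  have product := ((hE.hasFDerivAt hy).mul grad.hasFDerivAt).const_mul 2
  have quadratic := q.hasFDerivAt.clm_apply (hasFDerivAt_id y)
  have hEq : (fun z => 2 * (E z * α (hessGradient E α z))) =ᶠ[𝓝 y] fun z => q z z := by
    filter_upwards [isOpen_ne.mem_nhds hy] with z hz
    rw [← mul_assoc, h.two_mul_energy_mul z hz _ (hE.hess_hessGradient α hz)]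
  have := product.unique (quadratic.congr_of_eventuallyEq hEq)
  ext v
  have hv := congrArg (fun θ : V →L[ℝ] ℝ => θ v) this
  simp only [smul_add, add_apply, smul_apply, smul_eq_mul, ContinuousLinearMap.comp_id, id_eq,
    ContinuousLinearMap.flip_apply, h.symm v y] at hv ⊢
  linarith

theorem exists_fderiv_hessGradient_self_eq_smul (h : HasQuadraticGradient E α q) {y : V}
    (hy : y ≠ 0) : ∃ c : ℝ, fderiv ℝ (hessGradient E α) y (hessGradient E α y)
      = c • (hessGradient E α y - (α y / (2 * E y)) • y) := by
  have hE := h.isMinkowskiEnergy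
  have hEy := (hE.pos hy).ne'
  obtain ⟨a, b, hab⟩ := h.exists_apply_eq_smul_add_smul hy
  set f := fun z => α (hessGradient E α z)
  have hsum : f y • fderiv ℝ E y + E y • fderiv ℝ f y = a • α + b • fderiv ℝ E y :=
    (h.apply_hessGradient_smul_fderiv_add hy).trans hab
  have hcoeff : f y - b = a * α y / (2 * E y) := by
    have hself : a * α y + b * (2 * E y) = 2 * E y * f y := by
      rw [h.two_mul_energy_mul y hy _ (hE.hess_hessGradient α hy), hab, ← hE.fderiv_apply_self hy]
      simp
    field_simp
    linarith
  have hdf : E y • fderiv ℝ f y = a • (α - (α y / (2 * E y)) • fderiv ℝ E y) := by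
    rw [smul_sub, smul_smul, ← mul_div_assoc, ← hcoeff, eq_sub_of_add_eq' hsum]
    module
  refine ⟨a / E y, (hE.hess_isInvertible hy).injective ?_⟩
  rw [hE.hess_fderiv_hessGradient_self α hy, map_smul, map_sub, map_smul,
    hE.hess_hessGradient α hy, hE.hess_self hy, ← inv_smul_smul₀ hEy (fderiv ℝ f y), hdf, smul_smul,
    inv_mul_eq_div]

end HasQuadraticGradient

/-! ### Two-homogeneous functions with vanishing third derivative -/

theorem exists_bilin_of_iteratedFDeriv_three_eq_zero {V : Type*} [NormedAddCommGroup V]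
    [NormedSpace ℝ V] (hV : 1 < Module.rank ℝ V) {R : V → ℝ}
    (hR : ∀ y, y ≠ 0 → ContDiffAt ℝ 3 R y)
    (hhom : ∀ (y : V) (t : ℝ), 0 < t → R (t • y) = t ^ 2 * R y)
    (h3 : ∀ y, y ≠ 0 → iteratedFDeriv ℝ 3 R y = 0) :
    ∃ r : V →L[ℝ] V →L[ℝ] ℝ, (∀ v w, r v w = r w v) ∧ ∀ y, y ≠ 0 → 2 * R y = r y y := by
  have : Nontrivial V := (rank_pos_iff_nontrivial (R := ℝ)).1 (zero_lt_one.trans hV)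
  obtain ⟨y₀, hy₀⟩ := exists_ne (0 : V)
  have hconst : ∀ y, y ≠ 0 → iteratedFDeriv ℝ 2 R y = iteratedFDeriv ℝ 2 R y₀ := fun y hy => by
    refine isOpen_compl_singleton.is_const_of_fderiv_eq_zero (𝕜 := ℝ)
      (isConnected_compl_singleton_of_one_lt_rank hV 0).isPreconnected (fun z hz => ?_)
      (fun z hz => ?_) hy hy₀
    · exact (((hR z hz).iteratedFDeriv_right (m := 1) (i := 2) (by norm_num)).differentiableAt
        (by simp)).differentiableWithinAt
    · rw [fderiv_iteratedFDeriv, Function.comp_apply, h3 z hz, LinearIsometryEquiv.map_zero,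
        Pi.zero_apply]
  refine ⟨fderiv ℝ (fderiv ℝ R) y₀, (hR y₀ hy₀).isSymmSndFDerivAt (by norm_num),
    fun y hy => ?_⟩
  have hhess : fderiv ℝ (fderiv ℝ R) y y y = fderiv ℝ (fderiv ℝ R) y₀ y y := by
    simpa [iteratedFDeriv_two_apply] using congrArg (fun T => T ![y, y]) (hconst y hy)
  have hEuler₁ : fderiv ℝ R y y = 2 * R y := by
    simpa using fderiv_apply_self_of_homogeneous (k := 2) (hhom y)
      ((hR y hy).differentiableAt (by simp))
  have hEuler₂ : fderiv ℝ (fderiv ℝ R) y y = fderiv ℝ R y := by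
    simpa using fderiv_apply_self_of_homogeneous (k := 1) (h := fderiv ℝ R) (y := y)
      (fun t ht => by simpa using fderiv_smul_of_homogeneous (k := 1) hhom y ht)
      (((hR y hy).fderiv_right (m := 1) (by norm_num)).differentiableAt (by simp))
  rw [← hhess, hEuler₂, hEuler₁]

/-! ### The geodesic spray -/

theorem hess_const_mul {V : Type*} [NormedAddCommGroup V] [NormedSpace ℝ V] (E : V → ℝ) (c : ℝ)
    (y : V) : fderiv ℝ (fderiv ℝ fun z => c * E z) y = c • fderiv ℝ (fderiv ℝ E) y := by
  change fderiv ℝ (fderiv ℝ (c • E)) y = _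
  rw [fderiv_const_smul_field]
  exact congrFun (fderiv_const_smul_field (f := fderiv ℝ E) c) y

theorem IsMinkowskiEnergy.const_mul {V : Type*} [NormedAddCommGroup V] [NormedSpace ℝ V]
    {E : V → ℝ} (hE : IsMinkowskiEnergy E) {c : ℝ} (hc : 0 < c) :
    IsMinkowskiEnergy fun y => c * E y where
  contDiffAt y hy := contDiffAt_const.mul (hE.contDiffAt y hy)
  homogeneous y t ht := by rw [hE.homogeneous y t ht, mul_left_comm]
  hess_pos y hy v hv := by
    rw [hess_const_mul]
    exact mul_pos hc (hE.hess_pos y hy v hv)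

/-- `E` is to first order at `x` the energy of a Finsler metric on a trivialized tangent bundle:
`E x' y` is the energy of the vector `y` at the point `x'`. Only the smoothness in `y` of `E x` and
of the differential in `x` is required, which a conformal factor differentiable at `x` preserves. -/
structure IsFinslerEnergyAt {V : Type*} [NormedAddCommGroup V] [NormedSpace ℝ V] (E : V → V → ℝ)
    (x : V) : Prop where
  isMinkowskiEnergy : IsMinkowskiEnergy (E x)
  differentiableAt_left : ∀ y, y ≠ 0 → DifferentiableAt ℝ (E · y) x
  contDiffAt_fderiv_left : ∀ y, y ≠ 0 → ContDiffAt ℝ ∞ (fun z => fderiv ℝ (E · z) x) y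

/-- The geodesic spray `G` of the energy `E` at `(x, y)`, characterized by
`2 H(G, v) = D_y D_x E(v)(y) - D_x E(v)` for the vertical Hessian `H`; it is a junk value where `H`
is degenerate. -/
noncomputable def geodesicSpray {V : Type*} [NormedAddCommGroup V] [NormedSpace ℝ V]
    (E : V → V → ℝ) (x y : V) : V :=
  (1 / 2 : ℝ) • (fderiv ℝ (fderiv ℝ (E x)) y).inverse
    ((fderiv ℝ (fun z => fderiv ℝ (E · z) x) y).flip y - fderiv ℝ (E · y) x)

namespace IsFinslerEnergyAt

variable {V : Type*} [NormedAddCommGroup V] [NormedSpace ℝ V] {E : V → V → ℝ} {x y : V}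

theorem of_contDiffAt_uncurry
    (hsmooth : ∀ y, y ≠ 0 → ContDiffAt ℝ ∞ (Function.uncurry E) (x, y))
    (hE : IsMinkowskiEnergy (E x)) : IsFinslerEnergyAt E x where
  isMinkowskiEnergy := hE
  differentiableAt_left y hy :=
    DifferentiableAt.comp (g := Function.uncurry E) (f := fun x' => (x', y)) x
      ((hsmooth y hy).differentiableAt (by simp))
      (differentiableAt_id.prodMk (differentiableAt_const y))
  contDiffAt_fderiv_left y hy := by
    have hswap : ContDiffAt ℝ ∞ (Function.uncurry fun z x' => E x' z) (y, x) :=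
      (hsmooth y hy).comp (y, x) (contDiffAt_snd.prodMk contDiffAt_fst)
    exact hswap.fderiv contDiffAt_const (by simp)

theorem fderiv_conformal_left (h : IsFinslerEnergyAt E x) {a : V → ℝ}
    (ha : DifferentiableAt ℝ a x) (hy : y ≠ 0) :
    fderiv ℝ (fun x' => Real.exp (a x') ^ 2 * E x' y) x
      = Real.exp (a x) ^ 2 • (fderiv ℝ (E · y) x + (2 * E x y) • fderiv ℝ a x) := by
  have := (ha.hasFDerivAt.exp.pow 2).mul (h.differentiableAt_left y hy).hasFDerivAt
  refine this.fderiv.trans ?_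
  simp only [Nat.add_one_sub_one, pow_one, smul_smul, nsmul_eq_mul]
  module

theorem fderiv_conformal_left_eventuallyEq (h : IsFinslerEnergyAt E x) {a : V → ℝ}
    (ha : DifferentiableAt ℝ a x) (hy : y ≠ 0) :
    (fun z => fderiv ℝ (fun x' => Real.exp (a x') ^ 2 * E x' z) x) =ᶠ[𝓝 y]
      fun z => Real.exp (a x) ^ 2 • (fderiv ℝ (E · z) x + (2 * E x z) • fderiv ℝ a x) := by
  filter_upwards [isOpen_ne.mem_nhds hy] with z hz using h.fderiv_conformal_left ha hz

theorem fderiv_fderiv_conformal_left (h : IsFinslerEnergyAt E x) {a : V → ℝ}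
    (ha : DifferentiableAt ℝ a x) (hy : y ≠ 0) :
    (fderiv ℝ (fun z => fderiv ℝ (fun x' => Real.exp (a x') ^ 2 * E x' z) x) y).flip y
      = Real.exp (a x) ^ 2 • ((fderiv ℝ (fun z => fderiv ℝ (E · z) x) y).flip y
        + (2 * fderiv ℝ a x y) • fderiv ℝ (E x) y) := by
  have hD := ((h.contDiffAt_fderiv_left y hy).differentiableAt (by simp)).hasFDerivAt
  have hE := ((h.isMinkowskiEnergy.hasFDerivAt hy).const_mul 2).smul_const (fderiv ℝ a x)
  rw [(((hD.add hE).const_smul (Real.exp (a x) ^ 2)).congr_of_eventuallyEq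
    (h.fderiv_conformal_left_eventuallyEq ha hy)).fderiv]
  ext v
  simp [mul_assoc, mul_comm (fderiv ℝ (E x) y v)]

theorem conformal (h : IsFinslerEnergyAt E x) {a : V → ℝ} (ha : DifferentiableAt ℝ a x) :
    IsFinslerEnergyAt (fun x' y' => Real.exp (a x') ^ 2 * E x' y') x where
  isMinkowskiEnergy := h.isMinkowskiEnergy.const_mul (by positivity)
  differentiableAt_left y hy := (ha.exp.pow 2).mul (h.differentiableAt_left y hy)
  contDiffAt_fderiv_left y hy := by
    have hE : ContDiffAt ℝ ∞ (fun z => (2 * E x z) • fderiv ℝ a x) y :=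
      (contDiffAt_const.mul (h.isMinkowskiEnergy.contDiffAt y hy)).smul contDiffAt_const
    exact (((h.contDiffAt_fderiv_left y hy).add hE).const_smul _).congr_of_eventuallyEq
      (h.fderiv_conformal_left_eventuallyEq ha hy)

variable [FiniteDimensional ℝ V]

theorem contDiffAt_geodesicSpray (h : IsFinslerEnergyAt E x) (hy : y ≠ 0) :
    ContDiffAt ℝ ∞ (geodesicSpray E x) y := by
  have hD := h.contDiffAt_fderiv_left y hy
  have hDD := hD.fderiv_right (m := ∞) (by simp)
  let flip := (ContinuousLinearMap.flipₗᵢ ℝ V V ℝ).toContinuousLinearEquiv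
  have hflip := (flip.contDiff.comp_contDiffAt y hDD).clm_apply contDiffAt_id
  exact contDiffAt_const.smul
    ((h.isMinkowskiEnergy.contDiffAt_inverse_hess hy).clm_apply (hflip.sub hD))

theorem hess_geodesicSpray (h : IsFinslerEnergyAt E x) (hy : y ≠ 0) :
    fderiv ℝ (fderiv ℝ (E x)) y (geodesicSpray E x y) = (1 / 2 : ℝ) •
      ((fderiv ℝ (fun z => fderiv ℝ (E · z) x) y).flip y - fderiv ℝ (E · y) x) := by
  rw [geodesicSpray, map_smul, (h.isMinkowskiEnergy.hess_isInvertible hy).self_apply_inverse]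

theorem geodesicSpray_conformal (h : IsFinslerEnergyAt E x) {a : V → ℝ}
    (ha : DifferentiableAt ℝ a x) (hy : y ≠ 0) :
    geodesicSpray (fun x' y' => Real.exp (a x') ^ 2 * E x' y') x y
      = geodesicSpray E x y + fderiv ℝ a x y • y
        - E x y • hessGradient (E x) (fderiv ℝ a x) y := by
  have hE := h.isMinkowskiEnergy
  have h' := h.conformal ha
  refine (h'.isMinkowskiEnergy.hess_isInvertible hy).injective ?_
  rw [h'.hess_geodesicSpray hy, hess_const_mul, smul_apply, map_sub, map_add,
    h.hess_geodesicSpray hy, map_smul, map_smul, hE.hess_self hy, hE.hess_hessGradient _ hy,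
    h.fderiv_conformal_left ha hy, h.fderiv_fderiv_conformal_left ha hy]
  module

end IsFinslerEnergyAt

/-! ### Conformal changes preserving the third derivatives of the spray -/

namespace IsMinkowskiEnergy

variable {V : Type*} [NormedAddCommGroup V] [NormedSpace ℝ V] [FiniteDimensional ℝ V] {E : V → ℝ}

theorem contDiffAt_sq_sub_mul_hessGradient (hE : IsMinkowskiEnergy E) (α : V →L[ℝ] ℝ) {y : V}
    (hy : y ≠ 0) : ContDiffAt ℝ 3 (fun z => α z ^ 2 - E z * α (hessGradient E α z)) y := by
  have hX := α.contDiff.contDiffAt.comp y (hE.contDiffAt_hessGradient α hy)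
  exact ((α.contDiff.contDiffAt.pow 2).sub ((hE.contDiffAt y hy).mul hX)).of_le
    (by simpa using ENat.LEInfty.out)

theorem exists_hasQuadraticGradient (hE : IsMinkowskiEnergy E) (hV : 1 < Module.rank ℝ V)
    {α : V →L[ℝ] ℝ} (hα : α ≠ 0) (h3 : ∀ y, y ≠ 0 →
      iteratedFDeriv ℝ 3 (fun z => α z ^ 2 - E z * α (hessGradient E α z)) y = 0) :
    ∃ q, HasQuadraticGradient E α q := by
  have hhom (y : V) (t : ℝ) (ht : 0 < t) : α (t • y) ^ 2 - E (t • y) * α (hessGradient E α (t • y))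
      = t ^ 2 * (α y ^ 2 - E y * α (hessGradient E α y)) := by
    rw [map_smul, hE.homogeneous y t ht, hE.hessGradient_smul α y ht, smul_eq_mul]
    ring
  obtain ⟨r, hr, hrR⟩ := exists_bilin_of_iteratedFDeriv_three_eq_zero hV
    (fun y hy => hE.contDiffAt_sq_sub_mul_hessGradient α hy) hhom h3
  refine ⟨(2 : ℝ) • α.smulRight α - r, hE, hα, fun v w => ?_, fun y hy X hX => ?_⟩
  · simp [hr v w, mul_comm]
  · have hgrad : hessGradient E α y = X :=
      ((hE.hess_isInvertible hy).inverse_apply_eq).2 hX.symm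
    have hR := hrR y hy
    rw [hgrad] at hR
    simp only [sub_apply, smul_apply, ContinuousLinearMap.smulRight_apply, smul_eq_mul, ← hR]
    ring

theorem fderiv_hessGradient_self_of_rank_le_one (hE : IsMinkowskiEnergy E)
    (hV : Module.rank ℝ V ≤ 1) (α : V →L[ℝ] ℝ) {y : V} (hy : y ≠ 0) :
    fderiv ℝ (hessGradient E α) y (hessGradient E α y) = 0 := by
  obtain ⟨v, hv⟩ := rank_le_one_iff.1 hV
  obtain ⟨s, rfl⟩ := hv y
  obtain ⟨r, hr⟩ := hv (hessGradient E α (s • v))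
  have hs : s ≠ 0 := fun hs => hy (by rw [hs, zero_smul])
  have hradial : fderiv ℝ (hessGradient E α) (s • v) (s • v) = 0 := by
    simpa using fderiv_apply_self_of_homogeneous (k := 0)
      (fun t ht => by simpa using hE.hessGradient_smul α (s • v) ht)
      ((hE.contDiffAt_hessGradient α hy).differentiableAt (by simp))
  rw [← hr, ← div_mul_cancel₀ r hs, mul_smul, map_smul, hradial, smul_zero]

end IsMinkowskiEnergy

namespace IsFinslerEnergyAt

variable {V : Type*} [NormedAddCommGroup V] [NormedSpace ℝ V] [FiniteDimensional ℝ V]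
  {E : V → V → ℝ} {x : V} {a : V → ℝ}

theorem iteratedFDeriv_apply_geodesicSpray_conformal (h : IsFinslerEnergyAt E x)
    (ha : DifferentiableAt ℝ a x) {y : V} (hy : y ≠ 0) :
    iteratedFDeriv ℝ 3 (fun z => fderiv ℝ a x
        (geodesicSpray (fun x' y' => Real.exp (a x') ^ 2 * E x' y') x z)) y
      = iteratedFDeriv ℝ 3 (fun z => fderiv ℝ a x (geodesicSpray E x z)) y
        + iteratedFDeriv ℝ 3 (fun z => fderiv ℝ a x z ^ 2
          - E x z * fderiv ℝ a x (hessGradient (E x) (fderiv ℝ a x) z)) y := by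
  set α := fderiv ℝ a x
  have hEq : (fun z => α (geodesicSpray (fun x' y' => Real.exp (a x') ^ 2 * E x' y') x z)) =ᶠ[𝓝 y]
      (fun z => α (geodesicSpray E x z))
        + fun z => α z ^ 2 - E x z * α (hessGradient (E x) α z) := by
    filter_upwards [isOpen_ne.mem_nhds hy] with z hz
    rw [h.geodesicSpray_conformal ha hz]
    simp [α]
    ring
  rw [(hEq.iteratedFDeriv ℝ 3).eq_of_nhds, iteratedFDeriv_add_apply]
  · exact (α.contDiff.contDiffAt.comp y (h.contDiffAt_geodesicSpray hy)).of_le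
      (by simpa using ENat.LEInfty.out)
  · exact h.isMinkowskiEnergy.contDiffAt_sq_sub_mul_hessGradient α hy

theorem exists_fderiv_hessGradient_self_eq_smul (h : IsFinslerEnergyAt E x)
    (ha : DifferentiableAt ℝ a x)
    (hinv : ∀ y, y ≠ 0 → iteratedFDeriv ℝ 3 (fun z => fderiv ℝ a x
        (geodesicSpray (fun x' y' => Real.exp (a x') ^ 2 * E x' y') x z)) y
      = iteratedFDeriv ℝ 3 (fun z => fderiv ℝ a x (geodesicSpray E x z)) y)
    {y : V} (hy : y ≠ 0) :
    ∃ c : ℝ, fderiv ℝ (hessGradient (E x) (fderiv ℝ a x)) y (hessGradient (E x) (fderiv ℝ a x) y)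
      = c • (hessGradient (E x) (fderiv ℝ a x) y - (fderiv ℝ a x y / (2 * E x y)) • y) := by
  have hE := h.isMinkowskiEnergy
  rcases le_or_gt (Module.rank ℝ V) 1 with hV | hV
  · exact ⟨0, by rw [hE.fderiv_hessGradient_self_of_rank_le_one hV _ hy, zero_smul]⟩
  rcases eq_or_ne (fderiv ℝ a x) 0 with hα | hα
  · exact ⟨0, by simp [hα, hessGradient]⟩
  obtain ⟨q, hq⟩ := hE.exists_hasQuadraticGradient hV hα fun z hz => by
    simpa [hinv z hz] using h.iteratedFDeriv_apply_geodesicSpray_conformal ha hz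
  exact hq.exists_fderiv_hessGradient_self_eq_smul hy

end IsFinslerEnergyAt

/-! ### Coordinates -/

section Coordinates

variable {n : ℕ}

theorem apply_eq_sum_mul_apply_single (θ : EuclideanSpace ℝ (Fin n) →L[ℝ] ℝ)
    (v : EuclideanSpace ℝ (Fin n)) : θ v = ∑ i, v i * θ (EuclideanSpace.single i 1) := by
  conv_lhs => rw [← (EuclideanSpace.basisFun (Fin n) ℝ).sum_repr v]
  simp

theorem pd_apply {W : Type*} [NormedAddCommGroup W] [NormedSpace ℝ W]
    {θ : EuclideanSpace ℝ (Fin n) → W →L[ℝ] ℝ} {y : EuclideanSpace ℝ (Fin n)}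
    (hθ : DifferentiableAt ℝ θ y) (i : Fin n) (w : W) :
    pd i (fun z => θ z w) y = fderiv ℝ θ y (EuclideanSpace.single i 1) w := by
  rw [pd, fderiv_clm_apply hθ (differentiableAt_const w)]
  simp

theorem pd_congr {f g : EuclideanSpace ℝ (Fin n) → ℝ} {y : EuclideanSpace ℝ (Fin n)}
    (hfg : f =ᶠ[𝓝 y] g) (i : Fin n) : pd i f y = pd i g y := by
  rw [pd, hfg.fderiv_eq, pd]

theorem pd_iteratedFDeriv_apply {f : EuclideanSpace ℝ (Fin n) → ℝ} {y : EuclideanSpace ℝ (Fin n)}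
    {m : ℕ} (hf : ContDiffAt ℝ (m + 1) f y) (i : Fin n)
    (v : Fin m → EuclideanSpace ℝ (Fin n)) :
    pd i (fun z => iteratedFDeriv ℝ m f z v) y
      = iteratedFDeriv ℝ (m + 1) f y (Fin.cons (EuclideanSpace.single i 1) v) := by
  have hd : DifferentiableAt ℝ (iteratedFDeriv ℝ m f) y :=
    (hf.iteratedFDeriv_right (m := 1) (i := m) (by rw [add_comm])).differentiableAt (by simp)
  rw [iteratedFDeriv_succ_apply_left, pd,
    (hd.hasFDerivAt.continuousMultilinear_apply_const v).fderiv]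
  simp

theorem pd_pd_pd {f : EuclideanSpace ℝ (Fin n) → ℝ} {y : EuclideanSpace ℝ (Fin n)}
    (hf : ContDiffAt ℝ 3 f y) (i j k : Fin n) :
    pd k (pd j (pd i f)) y = iteratedFDeriv ℝ 3 f y ![EuclideanSpace.single k 1,
      EuclideanSpace.single j 1, EuclideanSpace.single i 1] := by
  have hfirst : pd i f = fun z => iteratedFDeriv ℝ 1 f z ![EuclideanSpace.single i 1] := by
    ext z
    simp [pd]
  have hsecond : pd j (pd i f) =ᶠ[𝓝 y] fun z =>
      iteratedFDeriv ℝ 2 f z ![EuclideanSpace.single j 1, EuclideanSpace.single i 1] := by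
    filter_upwards [(hf.of_le (m := 2) (by norm_num)).eventually (by simp)] with z hz
    rw [hfirst]
    exact pd_iteratedFDeriv_apply (by simpa [one_add_one_eq_two] using hz) j _
  rw [pd_congr hsecond k]
  exact pd_iteratedFDeriv_apply (by simpa [two_add_one_eq_three] using hf) k _

theorem energy_conformal (L : EuclideanSpace ℝ (Fin n) → EuclideanSpace ℝ (Fin n) → ℝ)
    (a : EuclideanSpace ℝ (Fin n) → ℝ) :
    energy (fun x y => Real.exp (a x) * L x y) = fun x y => Real.exp (a x) ^ 2 * energy L x y := by
  ext x y
  simp only [energy]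
  ring

variable {L : EuclideanSpace ℝ (Fin n) → EuclideanSpace ℝ (Fin n) → ℝ}
  {x y : EuclideanSpace ℝ (Fin n)}

theorem metric_apply (hE : ContDiffAt ℝ 2 (energy L x) y) (i j : Fin n) :
    metric L x y i j = fderiv ℝ (fderiv ℝ (energy L x)) y (EuclideanSpace.single i 1)
      (EuclideanSpace.single j 1) :=
  pd_apply ((hE.fderiv_right (m := 1) (by norm_num)).differentiableAt (by simp)) i _

theorem metric_mulVec_apply (hE : ContDiffAt ℝ 2 (energy L x) y)
    (w : EuclideanSpace ℝ (Fin n)) (i : Fin n) : (metric L x y).mulVec w i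
      = fderiv ℝ (fderiv ℝ (energy L x)) y (EuclideanSpace.single i 1) w := by
  rw [apply_eq_sum_mul_apply_single _ w]
  simp [Matrix.mulVec, dotProduct, metric_apply hE, mul_comm]

theorem dotProduct_metric_mulVec (hE : ContDiffAt ℝ 2 (energy L x) y)
    (v w : EuclideanSpace ℝ (Fin n)) : v ⬝ᵥ (metric L x y).mulVec w
      = fderiv ℝ (fderiv ℝ (energy L x)) y v w := by
  have := apply_eq_sum_mul_apply_single ((fderiv ℝ (fderiv ℝ (energy L x)) y).flip w) v
  simpa [dotProduct, metric_mulVec_apply hE] using this.symm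

end Coordinates

namespace IsFinslerEnergyAt

variable {n : ℕ} {L : EuclideanSpace ℝ (Fin n) → EuclideanSpace ℝ (Fin n) → ℝ}
  {x y : EuclideanSpace ℝ (Fin n)}

theorem contDiffAt_two (h : IsFinslerEnergyAt (energy L) x) (hy : y ≠ 0) :
    ContDiffAt ℝ 2 (energy L x) y :=
  (h.isMinkowskiEnergy.contDiffAt y hy).of_le (by simpa using ENat.LEInfty.out)

theorem isUnit_metric (h : IsFinslerEnergyAt (energy L) x) (hy : y ≠ 0) :
    IsUnit (metric L x y) := by
  rw [← Matrix.mulVec_injective_iff_isUnit]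
  refine (injective_iff_map_eq_zero (metric L x y).mulVecLin).2 fun w hw => ?_
  by_contra hw0
  refine (h.isMinkowskiEnergy.hess_pos y hy (WithLp.toLp 2 w) (by simpa using hw0)).ne' ?_
  rw [← dotProduct_metric_mulVec (h.contDiffAt_two hy)]
  exact (congrArg (w ⬝ᵥ ·) hw).trans (dotProduct_zero w)

theorem sum_inv_metric_mul (h : IsFinslerEnergyAt (energy L) x) (hy : y ≠ 0)
    (θ : EuclideanSpace ℝ (Fin n) →L[ℝ] ℝ) (l : Fin n) :
    ∑ m, (metric L x y)⁻¹ l m * θ (EuclideanSpace.single m 1)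
      = (fderiv ℝ (fderiv ℝ (energy L x)) y).inverse θ l := by
  have hE := h.isMinkowskiEnergy
  set X := (fderiv ℝ (fderiv ℝ (energy L x)) y).inverse θ
  have hX : (metric L x y).mulVec X = fun m => θ (EuclideanSpace.single m 1) := funext fun m => by
    rw [metric_mulVec_apply (h.contDiffAt_two hy), hE.hess_symm hy,
      (hE.hess_isInvertible hy).self_apply_inverse]
  have hdet := (Matrix.isUnit_iff_isUnit_det _).1 (h.isUnit_metric hy)
  change (metric L x y)⁻¹.mulVec (fun m => θ (EuclideanSpace.single m 1)) l = X l
  rw [← hX, Matrix.mulVec_mulVec, Matrix.nonsing_inv_mul _ hdet, Matrix.one_mulVec]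

theorem grad_eq (h : IsFinslerEnergyAt (energy L) x) (hy : y ≠ 0)
    (a : EuclideanSpace ℝ (Fin n) → ℝ) (l : Fin n) :
    grad L a l x y = hessGradient (energy L x) (fderiv ℝ a x) y l :=
  h.sum_inv_metric_mul hy _ l

theorem spray_eq (h : IsFinslerEnergyAt (energy L) x) (hy : y ≠ 0) (l : Fin n) :
    spray L l x y = geodesicSpray (energy L) x y l := by
  rw [geodesicSpray, PiLp.smul_apply, ← h.sum_inv_metric_mul hy, spray, smul_eq_mul]
  congr! 3 with m
  rw [sub_apply, ContinuousLinearMap.flip_apply, apply_eq_sum_mul_apply_single _ y, pd]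
  congr! 3 with k
  exact pd_apply ((h.contDiffAt_fderiv_left y hy).differentiableAt (by simp)) m _

theorem mixedCurvature_eq (h : IsFinslerEnergyAt (energy L) x) (hy : y ≠ 0) (l i j k : Fin n) :
    mixedCurvature L l i j k x y = -iteratedFDeriv ℝ 3 (geodesicSpray (energy L) x) y
      ![EuclideanSpace.single k 1, EuclideanSpace.single j 1, EuclideanSpace.single i 1] l := by
  have hG : ContDiffAt ℝ 3 (geodesicSpray (energy L) x) y :=
    (h.contDiffAt_geodesicSpray hy).of_le (by simpa using ENat.LEInfty.out)
  let coord := EuclideanSpace.proj (𝕜 := ℝ) l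
  have hspray : spray L l x =ᶠ[𝓝 y] coord ∘ geodesicSpray (energy L) x := by
    filter_upwards [isOpen_ne.mem_nhds hy] with z hz using h.spray_eq hz l
  rw [mixedCurvature, pd_pd_pd ((coord.contDiff.contDiffAt.comp y hG).congr_of_eventuallyEq hspray),
    (hspray.iteratedFDeriv ℝ 3).eq_of_nhds, coord.iteratedFDeriv_comp_left hG le_rfl]
  rfl

theorem sum_mixedCurvature_mul (h : IsFinslerEnergyAt (energy L) x) (hy : y ≠ 0)
    (a : EuclideanSpace ℝ (Fin n) → ℝ) (i j k : Fin n) :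
    ∑ l, mixedCurvature L l i j k x y * pd l a x
      = -iteratedFDeriv ℝ 3 (fun z => fderiv ℝ a x (geodesicSpray (energy L) x z)) y
        ![EuclideanSpace.single k 1, EuclideanSpace.single j 1, EuclideanSpace.single i 1] := by
  have hG : ContDiffAt ℝ 3 (geodesicSpray (energy L) x) y :=
    (h.contDiffAt_geodesicSpray hy).of_le (by simpa using ENat.LEInfty.out)
  have hcomp := (fderiv ℝ a x).iteratedFDeriv_comp_left hG le_rfl
  simp only [Function.comp_def] at hcomp
  rw [hcomp, ContinuousLinearMap.compContinuousMultilinearMap_coe, Function.comp_apply,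
    apply_eq_sum_mul_apply_single, ← Finset.sum_neg_distrib]
  simp only [h.mixedCurvature_eq hy, neg_mul, pd]

theorem projGrad_eq (h : IsFinslerEnergyAt (energy L) x) (hy : y ≠ 0)
    (a : EuclideanSpace ℝ (Fin n) → ℝ) :
    projGrad L a x y = hessGradient (energy L x) (fderiv ℝ a x) y
      - (fderiv ℝ a x y / (2 * energy L x y)) • y := by
  ext l
  rw [projGrad, h.grad_eq hy, apply_eq_sum_mul_apply_single _ y]
  rfl

theorem gradDerivGrad_eq (h : IsFinslerEnergyAt (energy L) x) (hy : y ≠ 0)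
    (a : EuclideanSpace ℝ (Fin n) → ℝ) :
    gradDerivGrad L a x y = fderiv ℝ (hessGradient (energy L x) (fderiv ℝ a x)) y
      (hessGradient (energy L x) (fderiv ℝ a x) y) := by
  set X := hessGradient (energy L x) (fderiv ℝ a x)
  ext l
  let coord := EuclideanSpace.proj (𝕜 := ℝ) l
  have hX := (h.isMinkowskiEnergy.contDiffAt_hessGradient (fderiv ℝ a x) hy).differentiableAt
    (by simp)
  have hgrad : grad L a l x =ᶠ[𝓝 y] coord ∘ X := by
    filter_upwards [isOpen_ne.mem_nhds hy] with z hz using h.grad_eq hz a l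
  have hfderiv : fderiv ℝ (grad L a l x) y = coord ∘L fderiv ℝ X y := by
    rw [hgrad.fderiv_eq, fderiv_comp y coord.differentiableAt hX, coord.fderiv]
  change _ = (coord ∘L fderiv ℝ X y) (X y)
  rw [apply_eq_sum_mul_apply_single, ← hfderiv, gradDerivGrad]
  simp only [h.grad_eq hy, pd, X]

theorem iteratedFDeriv_geodesicSpray_conformal_eq (h : IsFinslerEnergyAt (energy L) x)
    {a : EuclideanSpace ℝ (Fin n) → ℝ} (ha : DifferentiableAt ℝ a x) (hy : y ≠ 0)
    (hinv : ∀ i j k : Fin n,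
      ∑ l, mixedCurvature (fun x y => Real.exp (a x) * L x y) l i j k x y * pd l a x
        = ∑ l, mixedCurvature L l i j k x y * pd l a x) :
    iteratedFDeriv ℝ 3 (fun z => fderiv ℝ a x
        (geodesicSpray (fun x y => Real.exp (a x) ^ 2 * energy L x y) x z)) y
      = iteratedFDeriv ℝ 3 (fun z => fderiv ℝ a x (geodesicSpray (energy L) x z)) y := by
  have h' : IsFinslerEnergyAt (energy fun x y => Real.exp (a x) * L x y) x :=
    energy_conformal L a ▸ h.conformal ha
  refine ContinuousMultilinearMap.toMultilinearMap_injective <|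
    Module.Basis.ext_multilinear (fun _ => (EuclideanSpace.basisFun (Fin n) ℝ).toBasis)
      fun v => ?_
  have hv : (fun i => (EuclideanSpace.basisFun (Fin n) ℝ).toBasis (v i))
      = ![EuclideanSpace.single (v 0) (1 : ℝ), EuclideanSpace.single (v 1) 1,
        EuclideanSpace.single (v 2) 1] := by
    ext i : 1
    fin_cases i <;> simp
  have := hinv (v 2) (v 1) (v 0)
  rw [h.sum_mixedCurvature_mul hy, h'.sum_mixedCurvature_mul hy, neg_inj, energy_conformal,
    ← hv] at this
  exact this

theorem exists_gradDerivGrad_eq_smul (h : IsFinslerEnergyAt (energy L) x)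
    {a : EuclideanSpace ℝ (Fin n) → ℝ} (ha : DifferentiableAt ℝ a x)
    (hinv : ∀ y : EuclideanSpace ℝ (Fin n), y ≠ 0 → ∀ i j k : Fin n,
      ∑ l, mixedCurvature (fun x y => Real.exp (a x) * L x y) l i j k x y * pd l a x
        = ∑ l, mixedCurvature L l i j k x y * pd l a x)
    (hy : y ≠ 0) : ∃ c : ℝ, gradDerivGrad L a x y = c • projGrad L a x y := by
  obtain ⟨c, hc⟩ := h.exists_fderiv_hessGradient_self_eq_smul ha
    (fun z hz => h.iteratedFDeriv_geodesicSpray_conformal_eq ha hz (hinv z hz)) hy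
  exact ⟨c, by rw [h.gradDerivGrad_eq hy, h.projGrad_eq hy, hc]; rfl⟩

end IsFinslerEnergyAt

/-! ### Finsler metrics in charts -/

section Manifold

variable {n : ℕ} {M : Type*} [TopologicalSpace M]
  [ChartedSpace (EuclideanSpace ℝ (Fin n)) M]
  {e : OpenPartialHomeomorph M (EuclideanSpace ℝ (Fin n))}

theorem mdifferentiable_of_mem_maximalAtlas
    (he : e ∈ IsManifold.maximalAtlas (𝓡 n) ∞ M) : e.MDifferentiable (𝓡 n) (𝓡 n) :=
  ⟨(contMDiffOn_of_mem_maximalAtlas he).mdifferentiableOn (by simp),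
    (contMDiffOn_symm_of_mem_maximalAtlas he).mdifferentiableOn (by simp)⟩

theorem mfderiv_symm_ne_zero (he : e ∈ IsManifold.maximalAtlas (𝓡 n) ∞ M)
    {x : EuclideanSpace ℝ (Fin n)} (hx : x ∈ e.target) {y : EuclideanSpace ℝ (Fin n)}
    (hy : y ≠ 0) : mfderiv (𝓡 n) (𝓡 n) e.symm x y ≠ 0 := by
  intro h
  apply hy
  have hinj := ((mdifferentiable_of_mem_maximalAtlas he).symm.mfderiv_bijective hx).injective
  exact hinj (h.trans (map_zero _).symm)

theorem differentiableAt_comp_symm (he : e ∈ IsManifold.maximalAtlas (𝓡 n) ∞ M) {p : M}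
    (hpe : p ∈ e.source) {α : M → ℝ} (hα : MDifferentiableAt (𝓡 n) 𝓘(ℝ, ℝ) α p) :
    DifferentiableAt ℝ (α ∘ e.symm) (e p) := by
  rw [← e.left_inv hpe] at hα
  exact (hα.comp (e p) ((mdifferentiable_of_mem_maximalAtlas he).symm.mdifferentiableAt
    (e.map_source hpe))).differentiableAt

variable [IsManifold (𝓡 n) ∞ M]

theorem contMDiffAt_tangent_symm (he : e ∈ IsManifold.maximalAtlas (𝓡 n) ∞ M)
    {x : EuclideanSpace ℝ (Fin n)} (hx : x ∈ e.target) (y : EuclideanSpace ℝ (Fin n)) :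
    ContMDiffAt 𝓘(ℝ, EuclideanSpace ℝ (Fin n) × EuclideanSpace ℝ (Fin n)) (𝓡 n).tangent ∞
      (fun z : EuclideanSpace ℝ (Fin n) × EuclideanSpace ℝ (Fin n) =>
        (⟨e.symm z.1, mfderiv (𝓡 n) (𝓡 n) e.symm z.1 z.2⟩ : TangentBundle (𝓡 n) M)) (x, y) := by
  have hon := (contMDiffOn_symm_of_mem_maximalAtlas he).contMDiffOn_tangentMapWithin
    (m := ∞) (by simp) e.open_target.uniqueMDiffOn
  have hat : ContMDiffAt (𝓡 n).tangent (𝓡 n).tangent ∞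
      (tangentMapWithin (𝓡 n) (𝓡 n) e.symm e.target)
      (⟨x, y⟩ : TangentBundle (𝓡 n) (EuclideanSpace ℝ (Fin n))) := by
    refine hon.contMDiffAt ?_
    have : Continuous (Bundle.TotalSpace.proj :
      TangentBundle (𝓡 n) (EuclideanSpace ℝ (Fin n)) → EuclideanSpace ℝ (Fin n)) :=
      FiberBundle.continuous_proj _ _
    exact (e.open_target.preimage this).mem_nhds hx
  have hmodel : ContMDiffAt 𝓘(ℝ, EuclideanSpace ℝ (Fin n) × EuclideanSpace ℝ (Fin n))
      (𝓡 n).tangent ∞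
      (fun z : EuclideanSpace ℝ (Fin n) × EuclideanSpace ℝ (Fin n) =>
        (⟨z.1, z.2⟩ : TangentBundle (𝓡 n) (EuclideanSpace ℝ (Fin n)))) (x, y) := by
    rw [modelWithCornersSelf_prod]
    exact (contMDiff_tangentBundleModelSpaceHomeomorph_symm (I := 𝓡 n) (n := ∞)).contMDiffAt
  refine (hat.comp (x, y) hmodel).congr_of_eventuallyEq ?_
  filter_upwards [(e.open_target.preimage continuous_fst).mem_nhds hx] with z hz
  simp only [Function.comp_apply, tangentMapWithin]
  rw [mfderivWithin_of_isOpen e.open_target hz]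

theorem IsFinslerMetric.contDiffAt_inChart {F : TangentBundle (𝓡 n) M → ℝ}
    (hF : IsFinslerMetric F) (he : e ∈ IsManifold.maximalAtlas (𝓡 n) ∞ M)
    {x : EuclideanSpace ℝ (Fin n)} (hx : x ∈ e.target) {y : EuclideanSpace ℝ (Fin n)}
    (hy : y ≠ 0) : ContDiffAt ℝ ∞ (Function.uncurry (inChart F e)) (x, y) := by
  rw [← contMDiffAt_iff_contDiffAt]
  have hF' := hF.smooth ⟨e.symm x, mfderiv (𝓡 n) (𝓡 n) e.symm x y⟩
    (mfderiv_symm_ne_zero he hx hy)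
  refine (hF'.comp (x, y) (contMDiffAt_tangent_symm he hx y).contMDiffWithinAt
    (mapsTo_preimage _ _)).contMDiffAt ?_
  filter_upwards [(e.open_target.preimage continuous_fst).mem_nhds hx,
    (isOpen_ne.preimage continuous_snd).mem_nhds hy] with z hz hz'
  exact mfderiv_symm_ne_zero he hz hz'

theorem IsFinslerMetric.isMinkowskiEnergy {F : TangentBundle (𝓡 n) M → ℝ}
    (hF : IsFinslerMetric F) (he : e ∈ IsManifold.maximalAtlas (𝓡 n) ∞ M)
    {x : EuclideanSpace ℝ (Fin n)} (hx : x ∈ e.target) :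
    IsMinkowskiEnergy (energy (inChart F e) x) := by
  have hsmooth (y : EuclideanSpace ℝ (Fin n)) (hy : y ≠ 0) :
      ContDiffAt ℝ ∞ (energy (inChart F e) x) y :=
    contDiffAt_const.mul (((hF.contDiffAt_inChart he hx hy).comp y
      (contDiffAt_const.prodMk contDiffAt_id)).pow 2)
  refine ⟨hsmooth, fun y t ht => ?_, fun y hy v hv => ?_⟩
  · have hscale : inChart F e x (t • y) = t * inChart F e x y := by
      have hmap : mfderiv (𝓡 n) (𝓡 n) e.symm x (t • y)
          = t • mfderiv (𝓡 n) (𝓡 n) e.symm x y := (mfderiv (𝓡 n) (𝓡 n) e.symm x).map_smul t y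
      simpa only [inChart, hmap] using hF.homogeneous _ _ t ht
    rw [energy, hscale, energy]
    ring
  · rw [← dotProduct_metric_mulVec ((hsmooth y hy).of_le (by simpa using ENat.LEInfty.out))]
    exact (hF.posDef e he x hx y hy).dotProduct_mulVec_pos
      fun h => hv (PiLp.ext (congrFun h))

theorem IsFinslerMetric.isFinslerEnergyAt {F : TangentBundle (𝓡 n) M → ℝ}
    (hF : IsFinslerMetric F) (he : e ∈ IsManifold.maximalAtlas (𝓡 n) ∞ M)
    {x : EuclideanSpace ℝ (Fin n)} (hx : x ∈ e.target) :
    IsFinslerEnergyAt (energy (inChart F e)) x :=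
  .of_contDiffAt_uncurry
    (fun _ hy => contDiffAt_const.mul ((hF.contDiffAt_inChart he hx hy).pow 2))
    (hF.isMinkowskiEnergy he hx)

end Manifold

/-! ### Gram determinants -/

theorem inner2_smul_right {m : ℕ} (g : Matrix (Fin m) (Fin m) ℝ) (a b : Fin m → ℝ) (c : ℝ) :
    inner2 g a (c • b) = c * inner2 g a b := by
  simp only [inner2, Finset.mul_sum, Pi.smul_apply, smul_eq_mul]
  exact Finset.sum_congr rfl fun i _ => Finset.sum_congr rfl fun j _ => by ring

theorem inner2_smul_left {m : ℕ} (g : Matrix (Fin m) (Fin m) ℝ) (a b : Fin m → ℝ) (c : ℝ) :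
    inner2 g (c • a) b = c * inner2 g a b := by
  simp only [inner2, Finset.mul_sum, Pi.smul_apply, smul_eq_mul]
  exact Finset.sum_congr rfl fun i _ => Finset.sum_congr rfl fun j _ => by ring

theorem gramDet_smul_self {m : ℕ} (g : Matrix (Fin m) (Fin m) ℝ) (a : Fin m → ℝ) (c : ℝ) :
    gramDet g a (c • a) = 0 := by
  simp only [gramDet, Matrix.det_fin_two_of, inner2_smul_left, inner2_smul_right]
  ring

theorem not_linearIndependent_smul_self {R W : Type*} [Ring R] [Nontrivial R] [AddCommGroup W]
    [Module R W] (v : W) (c : R) : ¬ LinearIndependent R ![v, c • v] := by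
  rw [LinearIndependent.pair_iff]
  intro h
  exact one_ne_zero (neg_eq_zero.1 (h c (-1) (by rw [neg_one_smul, add_neg_cancel])).2)

end FinslerConformal

theorem theorem1_general {n : ℕ} {M : Type*} [TopologicalSpace M]
    [ChartedSpace (EuclideanSpace ℝ (Fin n)) M] [IsManifold (𝓡 n) ∞ M]
    (F : TangentBundle (𝓡 n) M → ℝ) (hF : IsFinslerMetric F)
    (α : M → ℝ) (p : M) (hα : MDifferentiableAt (𝓡 n) 𝓘(ℝ, ℝ) α p)
    (e : OpenPartialHomeomorph M (EuclideanSpace ℝ (Fin n)))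
    (he : e ∈ IsManifold.maximalAtlas (𝓡 n) ∞ M) (hpe : p ∈ e.source)
    (hinv : ∀ (y : EuclideanSpace ℝ (Fin n)), y ≠ 0 → ∀ i j k : Fin n,
      ∑ l, mixedCurvature (inChart (conformalChange α F) e) l i j k (e p) y
          * pd l (α ∘ e.symm) (e p)
        = ∑ l, mixedCurvature (inChart F e) l i j k (e p) y * pd l (α ∘ e.symm) (e p)) :
    ∀ y : EuclideanSpace ℝ (Fin n), y ≠ 0 →
      gramDet (metric (inChart F e) (e p) y)
          (projGrad (inChart F e) (α ∘ e.symm) (e p) y)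
          (gradDerivGrad (inChart F e) (α ∘ e.symm) (e p) y) = 0 ∧
      ¬ LinearIndependent ℝ
          ![projGrad (inChart F e) (α ∘ e.symm) (e p) y,
            gradDerivGrad (inChart F e) (α ∘ e.symm) (e p) y] := by
  intro y hy
  obtain ⟨c, hc⟩ := (hF.isFinslerEnergyAt he (e.map_source hpe)).exists_gradDerivGrad_eq_smul
    (differentiableAt_comp_symm he hpe hα) hinv hy
  rw [hc]
  exact ⟨gramDet_smul_self _ _ _, not_linearIndependent_smul_self _ _⟩

theorem theorem1 {n : ℕ} (hn : 3 ≤ n) {M : Type*} [TopologicalSpace M]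
    [ChartedSpace (EuclideanSpace ℝ (Fin n)) M] [IsManifold (𝓡 n) ∞ M]
    (F : TangentBundle (𝓡 n) M → ℝ) (hF : IsFinslerMetric F)
    (α : M → ℝ) (hα : ContMDiff (𝓡 n) 𝓘(ℝ, ℝ) ∞ α)
    (p : M) (hp : mfderiv (𝓡 n) 𝓘(ℝ, ℝ) α p ≠ 0)
    (e : OpenPartialHomeomorph M (EuclideanSpace ℝ (Fin n)))
    (he : e ∈ IsManifold.maximalAtlas (𝓡 n) ∞ M) (hpe : p ∈ e.source)
    (hcurv : IndicatrixPosCurved (inChart F e) (e p))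
    (hinv : ∀ (y : EuclideanSpace ℝ (Fin n)), y ≠ 0 → ∀ i j k : Fin n,
      ∑ l, mixedCurvature (inChart (conformalChange α F) e) l i j k (e p) y
          * pd l (α ∘ e.symm) (e p)
        = ∑ l, mixedCurvature (inChart F e) l i j k (e p) y * pd l (α ∘ e.symm) (e p)) :
    ∀ y : EuclideanSpace ℝ (Fin n), y ≠ 0 →
      gramDet (metric (inChart F e) (e p) y)
          (projGrad (inChart F e) (α ∘ e.symm) (e p) y)
          (gradDerivGrad (inChart F e) (α ∘ e.symm) (e p) y) = 0 ∧
      ¬ LinearIndependent ℝ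
          ![projGrad (inChart F e) (α ∘ e.symm) (e p) y,
            gradDerivGrad (inChart F e) (α ∘ e.symm) (e p) y] := by
  exact theorem1_general F hF α p (hα.mdifferentiableAt (by simp)) e he hpe hinv
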